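/- **Setting.** Let $(\mathbf{Lev},\preceq,\sqcap,\sqcup,\top,\bot)$ be a bounded lattice of security levels and $(\mathbf{Flo},\preccurlyeq,\curlywedge,\curlyvee,\top,\bot)$ a bounded lattice of flow policies. Each $F\in\mathbf{Flo}$ acts on $\mathbf{Lev}$ as a downward closure operator $l\mapsto F(l)$ (monotone, idempotent, $F(l)\preceq l$), such that $F\preccurlyeq G$ implies $F(l)\preceq G(l)$ for all $l$, and $\top(l)=l$. Write $l_1\preceq_F l_2$ for $F(l_1)\preceq F(l_2)$. Fix sets of reference names $a$, thread names $m,n$, domain names $d$ and type variables. An *effect* is a triple $s=\langle s.r,s.w,s.t\rangle$ of levels, with $s\sqcup s'=\langle s.r\sqcup s'.r,\ s.w\sqcap s'.w,\ s.t\sqcup s'.t\rangle$. Types are $\tau,\sigma,\theta::=t\mid\mathsf{unit}\mid\mathsf{bool}\mid\theta\,\mathsf{ref}_l\mid\tau\xrightarrow{j,F}_{s}\sigma$, with $t$ a type variable. **Language.** Values $V$, pseudo-values $X$ and expressions $M,N$ (up to renaming of bound variables) are $$V::=()\mid x\mid\lambda x.M\mid tt\mid ff\mid a,\qquad X::=V\mid\mathrm{fix}\,x.X,$$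 $$M::=X\mid M\,N\mid M;N\mid\ !M\mid M:=N\mid\mathrm{ref}_{l,\theta}M\mid\mathrm{if}\ M\ \mathrm{then}\ N_t\ \mathrm{else}\ N_f\mid\mathrm{flow}\ F\ \mathrm{in}\ M\mid\mathrm{allowed}\ F\ \mathrm{then}\ N_t\ \mathrm{else}\ N_f\mid\mathrm{thread}_l\,M\ \mathrm{at}\ d .$$ A pool $P$ is a partial map from thread names to expressions ($M^m\in P$ means $P(m)=M$), a store $S$ a partial map from references to values, a position tracker $T$ a partial map from thread names to domains, and an allowed-policy mapping $W$ a partial map from domains to flow policies. A reference labeling is a map $\Sigma=(\Sigma_1,\Sigma_2)$ from references to levels and types, a thread labeling a map $\Upsilon$ from thread names to levels, and a typing environment $\Gamma$ a partial map from variables to types. A configuration $\langle T,P,S\rangle$ is *well formed* if all references occurring in $P$ and in the values of $S$ lie in $\mathrm{dom}(S)$, all domain names occurring in them lie in $\mathrm{dom}(W)$, and $\mathrm{dom}(P)\subseteq\mathrm{dom}(T)$. Evaluation contexts are $E::=[]\mid E\,N\mid V\,E\mid E;N\mid\mathrm{ref}_{l,\theta}E\mid\ !E\mid E:=N\mid V:=E\mid\mathrm{if}\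 E\ \mathrm{then}\ N_t\ \mathrm{else}\ N_f\mid\mathrm{flow}\ F\ \mathrm{in}\ E$, and $\lceil E\rceil$ is the meet of all policies declared by $\mathrm{flow}$ around the hole ($\top$ if there are none). From a well-formed configuration with $M^m\in P$ and $M=E[R]$ there is a transition decorated with $\lceil E\rceil$ and $T(m)$, written $W\vdash\langle T,P,S\rangle\xrightarrow[T(m)]{\lceil E\rceil}\langle T',P',S'\rangle$, in which $m$ becomes $E[R']$, other threads are unchanged and, except where indicated, so are $T$ and $S$, for the following $R\to R'$: * $(\lambda x.M)V\to M\{V/x\}$; $\ \mathrm{if}\ tt\ \mathrm{then}\ N_t\ \mathrm{else}\ N_f\to N_t$; $\ \mathrm{if}\ ff\ \mathrm{then}\ N_t\ \mathrm{else}\ N_f\to N_f$; $\ V;N\to N$; $\ \mathrm{fix}\,x.X\to X\{\mathrm{fix}\,x.X/x\}$; $\ \mathrm{flow}\ F\ \mathrm{in}\ V\to V$; * $!a\to S(a)$; $\ a:=V\to()$ with $S'=S[a\mapsto V]$; $\ \mathrm{ref}_{l,\theta}V\to a$ with $S'=S[a\mapsto V]$, for any $a\notin\mathrm{dom}(S)$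 with $\Sigma(a)=(l,\theta)$; * $\mathrm{allowed}\ F\ \mathrm{then}\ N_t\ \mathrm{else}\ N_f\to N_t$ if $W(T(m))\preccurlyeq F$, and $\to N_f$ if $W(T(m))\not\preccurlyeq F$ (in both cases $W(T(m))$ must be defined); * $\mathrm{thread}_l\,N\ \mathrm{at}\ d\to()$ with $T'=T[n\mapsto d]$ and a new thread $N^n$ in the pool, for any $n\notin\mathrm{dom}(T)$ with $\Upsilon(n)=l$. $\twoheadrightarrow$ is the reflexive closure of the union of all these transition relations (zero or one step). **Type system.** Judgments $\Gamma\vdash^{j}_{F}M:s,\tau$ (with $\Sigma$ fixed) are defined inductively by: * $(),tt,ff,a,x$ have any effect $s$ and types $\mathsf{unit}$, $\mathsf{bool}$, $\mathsf{bool}$, $\Sigma_2(a)\,\mathsf{ref}_{\Sigma_1(a)}$, $\Gamma(x)$ respectively; * if $\Gamma,x{:}\tau\vdash^j_F M:s,\sigma$ then $\Gamma\vdash^{j'}_{F'}\lambda x.M:s',\tau\xrightarrow{j,F}_{s}\sigma$ for all $j',F',s'$; if $\Gamma,x{:}\tau\vdash^j_F X:s,\tau$ then $\Gamma\vdash^j_F\mathrm{fix}\,x.X:s,\tau$;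 * if $M:s,\tau\xrightarrow{j,F}_{s'}\sigma$, $N:s'',\tau$, $s.t\preceq_F s''.w$ and $s.r,s''.r\preceq_F s'.w$, then $M\,N:s\sqcup s'\sqcup s''\sqcup\langle\bot,\top,s.r\sqcup s''.r\rangle,\sigma$; * if $M:s,\tau$, $N:s',\sigma$ and $s.t\preceq_F s'.w$, then $M;N:s\sqcup s',\sigma$; * if $M:s,\theta$ and $s.r,s.t\preceq_F l$, then $\mathrm{ref}_{l,\theta}M:s\sqcup\langle\bot,l,\bot\rangle,\theta\,\mathsf{ref}_l$; * if $M:s,\theta\,\mathsf{ref}_l$, $N:s',\theta$, $s.t\preceq_F s'.w$ and $s.r,s'.r\preceq_F l$, then $M:=N:s\sqcup s'\sqcup\langle\bot,l,\bot\rangle,\mathsf{unit}$; * if $M:s,\theta\,\mathsf{ref}_l$ then $!M:s\sqcup\langle l,\top,\bot\rangle,\theta$; * if $M:s,\mathsf{bool}$, $N_t:s_t,\tau$, $N_f:s_f,\tau$ and $s.r\preceq_F s_t.w,s_f.w$, then $\mathrm{if}\ M\ \mathrm{then}\ N_t\ \mathrm{else}\ N_f:s\sqcup s_t\sqcup s_f\sqcup\langle\bot,\top,s.r\rangle,\tau$;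 * if $N_t:s_t,\tau$, $N_f:s_f,\tau$ and $j\preceq_F s_t.w,s_f.w$, then $\mathrm{allowed}\ F'\ \mathrm{then}\ N_t\ \mathrm{else}\ N_f:s_t\sqcup s_f\sqcup\langle j,\top,j\rangle,\tau$; * if $\Gamma\vdash^j_{F\curlywedge F'}N:s,\tau$ then $\Gamma\vdash^j_F\mathrm{flow}\ F'\ \mathrm{in}\ N:s,\tau$; if $\Gamma\vdash^l_\top M:s,\mathsf{unit}$ then $\Gamma\vdash^j_F\mathrm{thread}_l\,M\ \mathrm{at}\ d:\langle\bot,l\sqcap s.w,\bot\rangle,\mathsf{unit}$ (where omitted parameters are $\Gamma,j,F$ in premises and conclusion). **Distributed Non-disclosure.** $S_1=_{F,\ell}S_2$ means that $S_1,S_2$ agree, definedness included, on all $a$ with $\Sigma_1(a)\preceq_F\ell$; $T_1=_{F,\ell}T_2$ that $T_1,T_2$ agree on all $n$ with $\Upsilon(n)\preceq_F\ell$; $\langle T_1,S_1\rangle=_{F,\ell}\langle T_2,S_2\rangle$ means both. $S$ is $(\Sigma,\Gamma)$-*compatible* if $\Gamma\vdash^j_F S(a):s,\Sigma_2(a)$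 for all $a\in\mathrm{dom}(S)$ and all $j,F,s$. For a level $\ell$, a *bisimulation* is a symmetric relation $\mathcal R$ on pairs $\langle P,T\rangle$ such that, for all $(\Sigma,\Gamma)$-compatible $S_1,S_2$ with $\langle T_1,P_1,S_1\rangle$, $\langle T_2,P_2,S_2\rangle$ well formed, if $\langle P_1,T_1\rangle\,\mathcal R\,\langle P_2,T_2\rangle$, $W\vdash\langle T_1,P_1,S_1\rangle\xrightarrow[d]{F}\langle T_1',P_1',S_1'\rangle$, $\langle T_1,S_1\rangle=_{F,\ell}\langle T_2,S_2\rangle$, $(\mathrm{dom}(S_1')\setminus\mathrm{dom}(S_1))\cap\mathrm{dom}(S_2)=\emptyset$ and $(\mathrm{dom}(T_1')\setminus\mathrm{dom}(T_1))\cap\mathrm{dom}(T_2)=\emptyset$, then there are $P_2',T_2',S_2'$ with $W\vdash\langle T_2,P_2,S_2\rangle\twoheadrightarrow\langle T_2',P_2',S_2'\rangle$, $\langle T_1',S_1'\rangle=_{\top,\ell}\langle T_2',S_2'\rangle$, $\langle P_1',T_1'\rangle\,\mathcal R\,\langle P_2',T_2'\rangle$, and $S_1',S_2'$ are $(\Sigma,\Gamma)$-compatible.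 Let $\approx_\ell$ be the union of all bisimulations. $P$ satisfies *Distributed Non-disclosure* with respect to $W,\Sigma,\Upsilon,\Gamma$ if $\langle P,T_1\rangle\approx_\ell\langle P,T_2\rangle$ for all levels $\ell$ and all $T_1,T_2$ with $\mathrm{dom}(P)=\mathrm{dom}(T_1)=\mathrm{dom}(T_2)$ and $T_1=_{\top,\ell}T_2$. **Theorem (Soundness of Typing Distributed Non-disclosure).** Let $P$ be a pool of threads, $W$ an allowed-policy mapping, $\Sigma$ a reference labeling, $\Upsilon$ a thread labeling, and $\Gamma$ a typing environment that gives no variable a reference type (for example $\Gamma=\emptyset$). If for every $M^m\in P$ there are $s$ and $\tau$ such that $\Gamma\vdash^{\Upsilon(m)}_{\top}M:s,\tau$, then $P$ satisfies Distributed Non-disclosure with respect to $W,\Sigma,\Upsilon,\Gamma$. -/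

import Mathlib

namespace DistND

universe u v w x y z

/-! ### Security setting -/

/-- The lattice `Flo` of flow policies acts on the lattice `Lev` of security levels by downward
closure operators (monotone, restrictive, idempotent). `F ≤ G` means that `F` is at least as
permissive as `G`, so that `F` lowers levels at least as much as `G`; the strictest policy `⊤`
collapses nothing. -/
class FlowSetting (Lev : Type u) (Flo : Type v) [Lattice Lev] [BoundedOrder Lev]
    [Lattice Flo] [BoundedOrder Flo] where
  cl : Flo → Lev → Lev
  cl_mono : ∀ (F : Flo) (l₁ l₂ : Lev), l₁ ≤ l₂ → cl F l₁ ≤ cl F l₂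
  cl_le : ∀ (F : Flo) (l : Lev), cl F l ≤ l
  cl_idem : ∀ (F : Flo) (l : Lev), cl F (cl F l) = cl F l
  cl_perm : ∀ (F G : Flo), F ≤ G → ∀ l : Lev, cl F l ≤ cl G l
  cl_top : ∀ l : Lev, cl (⊤ : Flo) l = l

/-- The flow relation between levels that is determined by the flow policy `F`: the baseline
relation between the levels collapsed by `F`. -/
def FlowLE {Lev : Type u} {Flo : Type v} [Lattice Lev] [BoundedOrder Lev] [Lattice Flo]
    [BoundedOrder Flo] [FlowSetting Lev Flo] (F : Flo) (l₁ l₂ : Lev) : Prop :=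
  FlowSetting.cl F l₁ ≤ FlowSetting.cl F l₂

/-- Security effects: reading effect `r`, writing effect `w`, termination effect `t`. -/
structure Eff (Lev : Type u) where
  r : Lev
  w : Lev
  t : Lev

/-- The join of security effects (contravariant in the writing effect). -/
def Eff.join {Lev : Type u} [Lattice Lev] (s s' : Eff Lev) : Eff Lev :=
  ⟨s.r ⊔ s'.r, s.w ⊓ s'.w, s.t ⊔ s'.t⟩

/-- Types. `ref θ l` is the type of references of level `l` to values of type `θ`; `fn τ j F s σ`
is the type of functions from `τ` to `σ` with latent thread level `j`, latent flow policy `F` and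
latent effect `s`. -/
inductive Ty (Lev : Type u) (Flo : Type v) (TyVar : Type z) where
  | tvar (t : TyVar)
  | unit
  | bool
  | ref (θ : Ty Lev Flo TyVar) (l : Lev)
  | fn (τ : Ty Lev Flo TyVar) (j : Lev) (F : Flo) (s : Eff Lev) (σ : Ty Lev Flo TyVar)

/-! ### Expressions -/

/-- Expressions, up to renaming of bound variables: variables are de Bruijn indices, and `lam` and
`fix` each bind the index `0` in their body. The body of `fix` is meant to be a pseudo-value; the
typing rule and the reduction rule for `fix` both require it. -/
inductive Exp (Lev : Type u) (Flo : Type v) (Ref : Type w) (Dom : Type y) (TyVar : Type z) where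
  | nil
  | var (k : ℕ)
  | lam (M : Exp Lev Flo Ref Dom TyVar)
  | tt
  | ff
  | loc (a : Ref)
  | fix (X : Exp Lev Flo Ref Dom TyVar)
  | app (M N : Exp Lev Flo Ref Dom TyVar)
  | seq (M N : Exp Lev Flo Ref Dom TyVar)
  | deref (M : Exp Lev Flo Ref Dom TyVar)
  | assign (M N : Exp Lev Flo Ref Dom TyVar)
  | newref (l : Lev) (θ : Ty Lev Flo TyVar) (M : Exp Lev Flo Ref Dom TyVar)
  | cond (M Nt Nf : Exp Lev Flo Ref Dom TyVar)
  | flow (F : Flo) (M : Exp Lev Flo Ref Dom TyVar)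
  | allowed (F : Flo) (Nt Nf : Exp Lev Flo Ref Dom TyVar)
  | thread (l : Lev) (M : Exp Lev Flo Ref Dom TyVar) (d : Dom)

section Language

variable {Lev : Type u} {Flo : Type v} {Ref : Type w} {Nam : Type x} {Dom : Type y}
  {TyVar : Type z}

namespace Exp

/-- Values: `()`, variables, abstractions, booleans and reference names. -/
def IsVal : Exp Lev Flo Ref Dom TyVar → Prop
  | nil => True
  | var _ => True
  | lam _ => True
  | tt => True
  | ff => True
  | loc _ => True
  | _ => False

/-- Pseudo-values: values, and `fix` applied to pseudo-values. -/
def IsPseudo : Exp Lev Flo Ref Dom TyVar → Prop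
  | fix X => IsPseudo X
  | M => IsVal M

/-- Extension of a renaming of variables under one binder. -/
def upRen (ρ : ℕ → ℕ) : ℕ → ℕ
  | 0 => 0
  | k + 1 => ρ k + 1

/-- Renaming of the free variables. -/
def rename (ρ : ℕ → ℕ) : Exp Lev Flo Ref Dom TyVar → Exp Lev Flo Ref Dom TyVar
  | nil => nil
  | var k => var (ρ k)
  | lam M => lam (rename (upRen ρ) M)
  | tt => tt
  | ff => ff
  | loc a => loc a
  | fix X => fix (rename (upRen ρ) X)
  | app M N => app (rename ρ M) (rename ρ N)
  | seq M N => seq (rename ρ M) (rename ρ N)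
  | deref M => deref (rename ρ M)
  | assign M N => assign (rename ρ M) (rename ρ N)
  | newref l θ M => newref l θ (rename ρ M)
  | cond M Nt Nf => cond (rename ρ M) (rename ρ Nt) (rename ρ Nf)
  | flow F M => flow F (rename ρ M)
  | allowed F Nt Nf => allowed F (rename ρ Nt) (rename ρ Nf)
  | thread l M d => thread l (rename ρ M) d

/-- Extension of a substitution under one binder. -/
def upSub (η : ℕ → Exp Lev Flo Ref Dom TyVar) : ℕ → Exp Lev Flo Ref Dom TyVar
  | 0 => var 0
  | k + 1 => rename Nat.succ (η k)

/-- Simultaneous capture-avoiding substitution for the free variables. -/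
def subst (η : ℕ → Exp Lev Flo Ref Dom TyVar) :
    Exp Lev Flo Ref Dom TyVar → Exp Lev Flo Ref Dom TyVar
  | nil => nil
  | var k => η k
  | lam M => lam (subst (upSub η) M)
  | tt => tt
  | ff => ff
  | loc a => loc a
  | fix X => fix (subst (upSub η) X)
  | app M N => app (subst η M) (subst η N)
  | seq M N => seq (subst η M) (subst η N)
  | deref M => deref (subst η M)
  | assign M N => assign (subst η M) (subst η N)
  | newref l θ M => newref l θ (subst η M)
  | cond M Nt Nf => cond (subst η M) (subst η Nt) (subst η Nf)
  | flow F M => flow F (subst η M)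
  | allowed F Nt Nf => allowed F (subst η Nt) (subst η Nf)
  | thread l M d => thread l (subst η M) d

/-- The substitution that replaces the index `0` by `X` and lowers all other indices. -/
def single (X : Exp Lev Flo Ref Dom TyVar) : ℕ → Exp Lev Flo Ref Dom TyVar
  | 0 => X
  | k + 1 => var k

/-- `inst X M` replaces the variable bound around `M` (the index `0` of `M`) by `X`. -/
def inst (X M : Exp Lev Flo Ref Dom TyVar) : Exp Lev Flo Ref Dom TyVar :=
  subst (single X) M

/-- The reference names that occur in an expression. -/
def rn : Exp Lev Flo Ref Dom TyVar → Set Ref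
  | nil => ∅
  | var _ => ∅
  | lam M => rn M
  | tt => ∅
  | ff => ∅
  | loc a => {a}
  | fix X => rn X
  | app M N => rn M ∪ rn N
  | seq M N => rn M ∪ rn N
  | deref M => rn M
  | assign M N => rn M ∪ rn N
  | newref _ _ M => rn M
  | cond M Nt Nf => rn M ∪ rn Nt ∪ rn Nf
  | flow _ M => rn M
  | allowed _ Nt Nf => rn Nt ∪ rn Nf
  | thread _ M _ => rn M

/-- The domain names that occur in an expression. -/
def dn : Exp Lev Flo Ref Dom TyVar → Set Dom
  | nil => ∅
  | var _ => ∅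
  | lam M => dn M
  | tt => ∅
  | ff => ∅
  | loc _ => ∅
  | fix X => dn X
  | app M N => dn M ∪ dn N
  | seq M N => dn M ∪ dn N
  | deref M => dn M
  | assign M N => dn M ∪ dn N
  | newref _ _ M => dn M
  | cond M Nt Nf => dn M ∪ dn Nt ∪ dn Nf
  | flow _ M => dn M
  | allowed _ Nt Nf => dn Nt ∪ dn Nf
  | thread _ M d => insert d (dn M)

end Exp

/-- The type of values. -/
abbrev Val (Lev : Type u) (Flo : Type v) (Ref : Type w) (Dom : Type y) (TyVar : Type z) :=
  {V : Exp Lev Flo Ref Dom TyVar // V.IsVal}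

/-! ### Configurations -/

/-- The domain of a partial mapping. -/
def pdom {α : Type*} {β : Type*} (Z : α → Option β) : Set α := {a | Z a ≠ none}

/-- Pools of threads: partial mappings from thread names to expressions. The thread `M^m` belongs
to `P` when `P m = some M`. -/
abbrev Pool (Lev : Type u) (Flo : Type v) (Ref : Type w) (Nam : Type x) (Dom : Type y)
    (TyVar : Type z) := Nam → Option (Exp Lev Flo Ref Dom TyVar)

/-- Stores: partial mappings from reference names to values. -/
abbrev Store (Lev : Type u) (Flo : Type v) (Ref : Type w) (Dom : Type y) (TyVar : Type z) :=
  Ref → Option (Val Lev Flo Ref Dom TyVar)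

/-- Position-trackers: partial mappings from thread names to domain names. -/
abbrev Tracker (Nam : Type x) (Dom : Type y) := Nam → Option Dom

/-- Configurations. -/
structure Config (Lev : Type u) (Flo : Type v) (Ref : Type w) (Nam : Type x) (Dom : Type y)
    (TyVar : Type z) where
  T : Tracker Nam Dom
  P : Pool Lev Flo Ref Nam Dom TyVar
  S : Store Lev Flo Ref Dom TyVar

/-- Well-formed configurations, with respect to the allowed-policy mapping `W`. -/
structure Config.WF (W : Dom → Option Flo) (c : Config Lev Flo Ref Nam Dom TyVar) : Prop where
  pool_rn : ∀ m M, c.P m = some M → M.rn ⊆ pdom c.S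
  pool_dn : ∀ m M, c.P m = some M → M.dn ⊆ pdom W
  pool_dom : pdom c.P ⊆ pdom c.T
  store_rn : ∀ a V, c.S a = some V → V.1.rn ⊆ pdom c.S
  store_dn : ∀ a V, c.S a = some V → V.1.dn ⊆ pdom W

/-! ### Operational semantics -/

/-- Evaluation contexts. -/
inductive ECtx (Lev : Type u) (Flo : Type v) (Ref : Type w) (Dom : Type y) (TyVar : Type z) where
  | hole
  | appL (E : ECtx Lev Flo Ref Dom TyVar) (N : Exp Lev Flo Ref Dom TyVar)
  | appR (V : Val Lev Flo Ref Dom TyVar) (E : ECtx Lev Flo Ref Dom TyVar)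
  | seq (E : ECtx Lev Flo Ref Dom TyVar) (N : Exp Lev Flo Ref Dom TyVar)
  | newref (l : Lev) (θ : Ty Lev Flo TyVar) (E : ECtx Lev Flo Ref Dom TyVar)
  | deref (E : ECtx Lev Flo Ref Dom TyVar)
  | assignL (E : ECtx Lev Flo Ref Dom TyVar) (N : Exp Lev Flo Ref Dom TyVar)
  | assignR (V : Val Lev Flo Ref Dom TyVar) (E : ECtx Lev Flo Ref Dom TyVar)
  | cond (E : ECtx Lev Flo Ref Dom TyVar) (Nt Nf : Exp Lev Flo Ref Dom TyVar)
  | flow (F : Flo) (E : ECtx Lev Flo Ref Dom TyVar)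

namespace ECtx

/-- The expression obtained by placing `M` in the hole of an evaluation context. -/
def fill (M : Exp Lev Flo Ref Dom TyVar) :
    ECtx Lev Flo Ref Dom TyVar → Exp Lev Flo Ref Dom TyVar
  | hole => M
  | appL E N => .app (fill M E) N
  | appR V E => .app V.1 (fill M E)
  | seq E N => .seq (fill M E) N
  | newref l θ E => .newref l θ (fill M E)
  | deref E => .deref (fill M E)
  | assignL E N => .assign (fill M E) N
  | assignR V E => .assign V.1 (fill M E)
  | cond E Nt Nf => .cond (fill M E) Nt Nf
  | flow F E => .flow F (fill M E)

/-- The flow policy declared by an evaluation context: the meet of all flow policies that are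
declared around the hole. -/
def policy [Lattice Flo] [BoundedOrder Flo] : ECtx Lev Flo Ref Dom TyVar → Flo
  | hole => ⊤
  | appL E _ => policy E
  | appR _ E => policy E
  | seq E _ => policy E
  | newref _ _ E => policy E
  | deref E => policy E
  | assignL E _ => policy E
  | assignR _ E => policy E
  | cond E _ _ => policy E
  | flow F E => F ⊓ policy E

end ECtx

/-- Reduction of redexes. `Redex W Sg Up T m S R T' R' new S'` means that the redex `R`, in
evaluation position in the thread named `m`, reduces to `R'` while the state changes from `T, S`
to `T', S'`; `new` is the thread that is created, if any. `Sg` is the reference labeling and `Up`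
the thread labeling. -/
inductive Redex [Lattice Flo] [DecidableEq Ref] [DecidableEq Nam] (W : Dom → Option Flo)
    (Sg : Ref → Lev × Ty Lev Flo TyVar) (Up : Nam → Lev) (T : Tracker Nam Dom) (m : Nam)
    (S : Store Lev Flo Ref Dom TyVar) :
    Exp Lev Flo Ref Dom TyVar → Tracker Nam Dom → Exp Lev Flo Ref Dom TyVar →
      Option (Nam × Exp Lev Flo Ref Dom TyVar) → Store Lev Flo Ref Dom TyVar → Prop where
  | beta (M V : Exp Lev Flo Ref Dom TyVar) (hV : V.IsVal) :
      Redex W Sg Up T m S (.app (.lam M) V) T (Exp.inst V M) none S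
  | condTrue (Nt Nf : Exp Lev Flo Ref Dom TyVar) :
      Redex W Sg Up T m S (.cond .tt Nt Nf) T Nt none S
  | condFalse (Nt Nf : Exp Lev Flo Ref Dom TyVar) :
      Redex W Sg Up T m S (.cond .ff Nt Nf) T Nf none S
  | seq (V N : Exp Lev Flo Ref Dom TyVar) (hV : V.IsVal) :
      Redex W Sg Up T m S (.seq V N) T N none S
  | fix (X : Exp Lev Flo Ref Dom TyVar) (hX : X.IsPseudo) :
      Redex W Sg Up T m S (.fix X) T (Exp.inst (.fix X) X) none S
  | flow (F : Flo) (V : Exp Lev Flo Ref Dom TyVar) (hV : V.IsVal) :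
      Redex W Sg Up T m S (.flow F V) T V none S
  | deref (a : Ref) (V : Val Lev Flo Ref Dom TyVar) (ha : S a = some V) :
      Redex W Sg Up T m S (.deref (.loc a)) T V.1 none S
  | assign (a : Ref) (V : Val Lev Flo Ref Dom TyVar) :
      Redex W Sg Up T m S (.assign (.loc a) V.1) T .nil none (Function.update S a (some V))
  | newref (l : Lev) (θ : Ty Lev Flo TyVar) (V : Val Lev Flo Ref Dom TyVar) (a : Ref)
      (ha : a ∉ pdom S) (hl : Sg a = (l, θ)) :
      Redex W Sg Up T m S (.newref l θ V.1) T (.loc a) none (Function.update S a (some V))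
  | allowedTrue (F : Flo) (Nt Nf : Exp Lev Flo Ref Dom TyVar) (d : Dom) (A : Flo)
      (hd : T m = some d) (hA : W d = some A) (hF : A ≤ F) :
      Redex W Sg Up T m S (.allowed F Nt Nf) T Nt none S
  | allowedFalse (F : Flo) (Nt Nf : Exp Lev Flo Ref Dom TyVar) (d : Dom) (A : Flo)
      (hd : T m = some d) (hA : W d = some A) (hF : ¬ A ≤ F) :
      Redex W Sg Up T m S (.allowed F Nt Nf) T Nf none S
  | thread (l : Lev) (N : Exp Lev Flo Ref Dom TyVar) (d : Dom) (n : Nam)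
      (hn : n ∉ pdom T) (hl : Up n = l) :
      Redex W Sg Up T m S (.thread l N d) (Function.update T n (some d)) .nil (some (n, N)) S

/-- The pool `P` after the thread `m` has become `M'` and the thread `new`, if any, was added. -/
def Pool.next [DecidableEq Nam] (P : Pool Lev Flo Ref Nam Dom TyVar) (m : Nam)
    (M' : Exp Lev Flo Ref Dom TyVar) (new : Option (Nam × Exp Lev Flo Ref Dom TyVar)) :
    Pool Lev Flo Ref Nam Dom TyVar :=
  match new with
  | none => Function.update P m (some M')
  | some (n, N) => Function.update (Function.update P m (some M')) n (some N)

/-- The transition relation between configurations: a thread `m` of the pool reduces a redex in an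
evaluation context `E` and the other threads are left as they are. The transition is decorated
with the flow policy declared by `E` and with the domain where `m` is located. Only well-formed
configurations have transitions. -/
inductive Step [Lattice Flo] [BoundedOrder Flo] [DecidableEq Ref] [DecidableEq Nam]
    (W : Dom → Option Flo) (Sg : Ref → Lev × Ty Lev Flo TyVar) (Up : Nam → Lev) :
    Config Lev Flo Ref Nam Dom TyVar → Flo → Dom → Config Lev Flo Ref Nam Dom TyVar → Prop where
  | mk (T T' : Tracker Nam Dom) (P : Pool Lev Flo Ref Nam Dom TyVar)
      (S S' : Store Lev Flo Ref Dom TyVar) (m : Nam) (d : Dom)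
      (E : ECtx Lev Flo Ref Dom TyVar) (R R' : Exp Lev Flo Ref Dom TyVar)
      (new : Option (Nam × Exp Lev Flo Ref Dom TyVar))
      (hwf : Config.WF W ⟨T, P, S⟩) (hm : P m = some (E.fill R)) (hd : T m = some d)
      (hR : Redex W Sg Up T m S R T' R' new S') :
      Step W Sg Up ⟨T, P, S⟩ E.policy d ⟨T', P.next m (E.fill R') new, S'⟩

/-- The reflexive closure of the transition relation: at most one step. -/
def StepRefl [Lattice Flo] [BoundedOrder Flo] [DecidableEq Ref] [DecidableEq Nam]
    (W : Dom → Option Flo) (Sg : Ref → Lev × Ty Lev Flo TyVar) (Up : Nam → Lev)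
    (c c' : Config Lev Flo Ref Nam Dom TyVar) : Prop :=
  c' = c ∨ ∃ F d, Step W Sg Up c F d c'

/-! ### Type and effect system -/

/-- Typing environments: partial mappings from variables to types. -/
abbrev Ctx (Lev : Type u) (Flo : Type v) (TyVar : Type z) := ℕ → Option (Ty Lev Flo TyVar)

/-- The typing environment under a binder whose variable (the index `0`) has type `τ`. -/
def Ctx.cons (τ : Ty Lev Flo TyVar) (Γ : Ctx Lev Flo TyVar) : Ctx Lev Flo TyVar
  | 0 => some τ
  | k + 1 => Γ k

variable [Lattice Lev] [BoundedOrder Lev] [Lattice Flo] [BoundedOrder Flo]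

/-- `Typed Sg j F Γ M s τ`: in the typing environment `Γ`, for the reference labeling `Sg`, the
thread level `j` and the flow policy `F` declared by the context, the expression `M` has the
security effect `s` and the type `τ`. -/
inductive Typed [FlowSetting Lev Flo] (Sg : Ref → Lev × Ty Lev Flo TyVar) :
    Lev → Flo → Ctx Lev Flo TyVar → Exp Lev Flo Ref Dom TyVar → Eff Lev → Ty Lev Flo TyVar →
      Prop where
  | nil (j : Lev) (F : Flo) (Γ : Ctx Lev Flo TyVar) (s : Eff Lev) :
      Typed Sg j F Γ .nil s .unit
  | tt (j : Lev) (F : Flo) (Γ : Ctx Lev Flo TyVar) (s : Eff Lev) :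
      Typed Sg j F Γ .tt s .bool
  | ff (j : Lev) (F : Flo) (Γ : Ctx Lev Flo TyVar) (s : Eff Lev) :
      Typed Sg j F Γ .ff s .bool
  | loc (j : Lev) (F : Flo) (Γ : Ctx Lev Flo TyVar) (s : Eff Lev) (a : Ref) :
      Typed Sg j F Γ (.loc a) s (.ref (Sg a).2 (Sg a).1)
  | var (j : Lev) (F : Flo) (Γ : Ctx Lev Flo TyVar) (s : Eff Lev) (k : ℕ) (τ : Ty Lev Flo TyVar)
      (hk : Γ k = some τ) :
      Typed Sg j F Γ (.var k) s τ
  | abs (j j' : Lev) (F F' : Flo) (Γ : Ctx Lev Flo TyVar) (s s' : Eff Lev)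
      (M : Exp Lev Flo Ref Dom TyVar) (τ σ : Ty Lev Flo TyVar)
      (hM : Typed Sg j F (Ctx.cons τ Γ) M s σ) :
      Typed Sg j' F' Γ (.lam M) s' (.fn τ j F s σ)
  | fix (j : Lev) (F : Flo) (Γ : Ctx Lev Flo TyVar) (s : Eff Lev)
      (X : Exp Lev Flo Ref Dom TyVar) (τ : Ty Lev Flo TyVar) (hX : X.IsPseudo)
      (h : Typed Sg j F (Ctx.cons τ Γ) X s τ) :
      Typed Sg j F Γ (.fix X) s τ
  | app (j : Lev) (F : Flo) (Γ : Ctx Lev Flo TyVar) (s s' s'' : Eff Lev)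
      (M N : Exp Lev Flo Ref Dom TyVar) (τ σ : Ty Lev Flo TyVar)
      (hM : Typed Sg j F Γ M s (.fn τ j F s' σ)) (hN : Typed Sg j F Γ N s'' τ)
      (h₁ : FlowLE F s.t s''.w) (h₂ : FlowLE F s.r s'.w) (h₃ : FlowLE F s''.r s'.w) :
      Typed Sg j F Γ (.app M N) (((s.join s').join s'').join ⟨⊥, ⊤, s.r ⊔ s''.r⟩) σ
  | seq (j : Lev) (F : Flo) (Γ : Ctx Lev Flo TyVar) (s s' : Eff Lev)
      (M N : Exp Lev Flo Ref Dom TyVar) (τ σ : Ty Lev Flo TyVar)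
      (hM : Typed Sg j F Γ M s τ) (hN : Typed Sg j F Γ N s' σ) (h₁ : FlowLE F s.t s'.w) :
      Typed Sg j F Γ (.seq M N) (s.join s') σ
  | newref (j : Lev) (F : Flo) (Γ : Ctx Lev Flo TyVar) (s : Eff Lev) (l : Lev)
      (θ : Ty Lev Flo TyVar) (M : Exp Lev Flo Ref Dom TyVar)
      (hM : Typed Sg j F Γ M s θ) (h₁ : FlowLE F s.r l) (h₂ : FlowLE F s.t l) :
      Typed Sg j F Γ (.newref l θ M) (s.join ⟨⊥, l, ⊥⟩) (.ref θ l)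
  | assign (j : Lev) (F : Flo) (Γ : Ctx Lev Flo TyVar) (s s' : Eff Lev) (l : Lev)
      (θ : Ty Lev Flo TyVar) (M N : Exp Lev Flo Ref Dom TyVar)
      (hM : Typed Sg j F Γ M s (.ref θ l)) (hN : Typed Sg j F Γ N s' θ)
      (h₁ : FlowLE F s.t s'.w) (h₂ : FlowLE F s.r l) (h₃ : FlowLE F s'.r l) :
      Typed Sg j F Γ (.assign M N) ((s.join s').join ⟨⊥, l, ⊥⟩) .unit
  | deref (j : Lev) (F : Flo) (Γ : Ctx Lev Flo TyVar) (s : Eff Lev) (l : Lev)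
      (θ : Ty Lev Flo TyVar) (M : Exp Lev Flo Ref Dom TyVar)
      (hM : Typed Sg j F Γ M s (.ref θ l)) :
      Typed Sg j F Γ (.deref M) (s.join ⟨l, ⊤, ⊥⟩) θ
  | cond (j : Lev) (F : Flo) (Γ : Ctx Lev Flo TyVar) (s st sf : Eff Lev)
      (M Nt Nf : Exp Lev Flo Ref Dom TyVar) (τ : Ty Lev Flo TyVar)
      (hM : Typed Sg j F Γ M s .bool) (ht : Typed Sg j F Γ Nt st τ) (hf : Typed Sg j F Γ Nf sf τ)
      (h₁ : FlowLE F s.r st.w) (h₂ : FlowLE F s.r sf.w) :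
      Typed Sg j F Γ (.cond M Nt Nf) (((s.join st).join sf).join ⟨⊥, ⊤, s.r⟩) τ
  | allowed (j : Lev) (F F' : Flo) (Γ : Ctx Lev Flo TyVar) (st sf : Eff Lev)
      (Nt Nf : Exp Lev Flo Ref Dom TyVar) (τ : Ty Lev Flo TyVar)
      (ht : Typed Sg j F Γ Nt st τ) (hf : Typed Sg j F Γ Nf sf τ)
      (h₁ : FlowLE F j st.w) (h₂ : FlowLE F j sf.w) :
      Typed Sg j F Γ (.allowed F' Nt Nf) ((st.join sf).join ⟨j, ⊤, j⟩) τ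
  | flow (j : Lev) (F F' : Flo) (Γ : Ctx Lev Flo TyVar) (s : Eff Lev)
      (N : Exp Lev Flo Ref Dom TyVar) (τ : Ty Lev Flo TyVar)
      (hN : Typed Sg j (F ⊓ F') Γ N s τ) :
      Typed Sg j F Γ (.flow F' N) s τ
  | mig (j l : Lev) (F : Flo) (Γ : Ctx Lev Flo TyVar) (s : Eff Lev)
      (M : Exp Lev Flo Ref Dom TyVar) (d : Dom)
      (hM : Typed Sg l ⊤ Γ M s .unit) :
      Typed Sg j F Γ (.thread l M d) ⟨⊥, l ⊓ s.w, ⊥⟩ .unit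

/-! ### Distributed Non-disclosure -/

/-- Low-equality of stores with respect to the flow policy `F` at the level `l`: they coincide on
the references whose level is below `l` according to `F`. -/
def LowEqStore [FlowSetting Lev Flo] (Sg : Ref → Lev × Ty Lev Flo TyVar) (F : Flo) (l : Lev)
    (S₁ S₂ : Store Lev Flo Ref Dom TyVar) : Prop :=
  ∀ a, FlowLE F (Sg a).1 l → S₁ a = S₂ a

/-- Low-equality of position-trackers: they coincide on the thread names whose level is below `l`
according to `F`. -/
def LowEqTracker [FlowSetting Lev Flo] (Up : Nam → Lev) (F : Flo) (l : Lev)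
    (T₁ T₂ : Tracker Nam Dom) : Prop :=
  ∀ n, FlowLE F (Up n) l → T₁ n = T₂ n

/-- Low-equality of states. -/
def LowEqState [FlowSetting Lev Flo] (Sg : Ref → Lev × Ty Lev Flo TyVar) (Up : Nam → Lev)
    (F : Flo) (l : Lev) (T₁ : Tracker Nam Dom) (S₁ : Store Lev Flo Ref Dom TyVar)
    (T₂ : Tracker Nam Dom) (S₂ : Store Lev Flo Ref Dom TyVar) : Prop :=
  LowEqStore Sg F l S₁ S₂ ∧ LowEqTracker Up F l T₁ T₂

/-- A store is compatible with `Sg` and `Γ` when the value of each reference `a` in its domain has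
the type `(Sg a).2`, for every thread level, flow policy and effect. -/
def Compatible [FlowSetting Lev Flo] (Sg : Ref → Lev × Ty Lev Flo TyVar)
    (Γ : Ctx Lev Flo TyVar) (S : Store Lev Flo Ref Dom TyVar) : Prop :=
  ∀ a V, S a = some V → ∀ (j : Lev) (F : Flo) (s : Eff Lev), Typed Sg j F Γ V.1 s (Sg a).2

/-- Thread configurations. -/
abbrev ThreadConf (Lev : Type u) (Flo : Type v) (Ref : Type w) (Nam : Type x) (Dom : Type y)
    (TyVar : Type z) := Pool Lev Flo Ref Nam Dom TyVar × Tracker Nam Dom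

/-- Information flow bisimulations at the observation level `l`. Both configurations from which
the matching starts are well formed (for the first one this is part of `Step`). -/
def IsBisim [FlowSetting Lev Flo] [DecidableEq Ref] [DecidableEq Nam] (W : Dom → Option Flo)
    (Sg : Ref → Lev × Ty Lev Flo TyVar) (Up : Nam → Lev) (Γ : Ctx Lev Flo TyVar) (l : Lev)
    (B : ThreadConf Lev Flo Ref Nam Dom TyVar → ThreadConf Lev Flo Ref Nam Dom TyVar → Prop) :
    Prop :=
  (∀ c₁ c₂, B c₁ c₂ → B c₂ c₁) ∧
  ∀ (P₁ P₂ P₁' : Pool Lev Flo Ref Nam Dom TyVar) (T₁ T₂ T₁' : Tracker Nam Dom)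
    (S₁ S₂ S₁' : Store Lev Flo Ref Dom TyVar) (F : Flo) (d : Dom),
    Compatible Sg Γ S₁ → Compatible Sg Γ S₂ →
    Config.WF W ⟨T₂, P₂, S₂⟩ →
    B (P₁, T₁) (P₂, T₂) →
    Step W Sg Up ⟨T₁, P₁, S₁⟩ F d ⟨T₁', P₁', S₁'⟩ →
    LowEqState Sg Up F l T₁ S₁ T₂ S₂ →
    (pdom S₁' \ pdom S₁) ∩ pdom S₂ = ∅ →
    (pdom T₁' \ pdom T₁) ∩ pdom T₂ = ∅ →
    ∃ (P₂' : Pool Lev Flo Ref Nam Dom TyVar) (T₂' : Tracker Nam Dom)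
      (S₂' : Store Lev Flo Ref Dom TyVar),
      StepRefl W Sg Up ⟨T₂, P₂, S₂⟩ ⟨T₂', P₂', S₂'⟩ ∧
      LowEqState Sg Up (⊤ : Flo) l T₁' S₁' T₂' S₂' ∧
      B (P₁', T₁') (P₂', T₂') ∧
      Compatible Sg Γ S₁' ∧ Compatible Sg Γ S₂'

/-- The union of all information flow bisimulations at the level `l`. -/
def Bisimilar [FlowSetting Lev Flo] [DecidableEq Ref] [DecidableEq Nam] (W : Dom → Option Flo)
    (Sg : Ref → Lev × Ty Lev Flo TyVar) (Up : Nam → Lev) (Γ : Ctx Lev Flo TyVar) (l : Lev)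
    (c₁ c₂ : ThreadConf Lev Flo Ref Nam Dom TyVar) : Prop :=
  ∃ B, IsBisim W Sg Up Γ l B ∧ B c₁ c₂

/-- Distributed Non-disclosure. -/
def DND [FlowSetting Lev Flo] [DecidableEq Ref] [DecidableEq Nam] (W : Dom → Option Flo)
    (Sg : Ref → Lev × Ty Lev Flo TyVar) (Up : Nam → Lev) (Γ : Ctx Lev Flo TyVar)
    (P : Pool Lev Flo Ref Nam Dom TyVar) : Prop :=
  ∀ (l : Lev) (T₁ T₂ : Tracker Nam Dom), pdom P = pdom T₁ → pdom P = pdom T₂ →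
    LowEqTracker Up (⊤ : Flo) l T₁ T₂ → Bisimilar W Sg Up Γ l (P, T₁) (P, T₂)

end Language

end DistND

namespace DistND

universe u v w x y z

variable {Lev : Type u} {Flo : Type v} {Ref : Type w} {Nam : Type x} {Dom : Type y}
  {TyVar : Type z}

/-! ### Values, contexts and substitution -/

/-! Two runs from low-equal states execute the same code until control depends on hidden
information; from then on the type system only permits invisible writes. The bisimulation relates
pools thread by thread (`ThreadRel`). It ignores stores and trackers, since every step of the
bisimulation game assumes low-equality afresh.

Threads of the same name are related by `Lockstep`. It follows the shape of evaluation contexts and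
ends in equal typed expressions, in values that may differ only if their reading effect is hidden at
`ℓ` (`ValPair`), or in arbitrary expressions that write only above a hidden level `k` (`HighPair`).

The side conditions of the typing rules keep this relation closed under steps. If two values differ,
then `cl F r` is hidden, and a condition `FlowLE F r w` gives `cl F r ≤ w`; so whatever these values
control writes above the hidden level `k = cl F r`. A `HighPair` moreover has `k` below `cl F r` and
`cl F t`. Hence the conditions that the surrounding context puts on `r` and `t` push `k` below the
writes of the continuation: once a high subterm has become a value, the enclosing pair is high too.
This is why application, conditional and `allowed` add the deciding level to the termination effect.

Given a step of `E[R]`, `Lockstep.matches_step` descends along `E`. At a high pair the second thread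
stands still, because the step changes nothing visible and any spawned thread is high. Otherwise
`Lockstep.matches_redex` reduces a redex of the same form on the other side. Dereferencing is sound
because the states agree at the policy declared by `E`. A policy test has the same outcome in both
runs when the position of the thread is visible, and is high otherwise. The assumption on `Γ` makes
every value of reference type a reference name, so that the matching redex is not stuck on a
variable. -/

theorem Exp.IsVal.isPseudo {M : Exp Lev Flo Ref Dom TyVar} (h : M.IsVal) : M.IsPseudo := by
  cases M <;> first | exact h | exact h.elim

theorem Exp.IsPseudo.rename {M : Exp Lev Flo Ref Dom TyVar} :
    ∀ {ρ : ℕ → ℕ}, M.IsPseudo → (M.rename ρ).IsPseudo := by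
  induction M with
  | fix X ih => intro ρ h; exact ih (ρ := Exp.upRen ρ) h
  | _ => intro ρ h; exact h

theorem Exp.isPseudo_upSub {η : ℕ → Exp Lev Flo Ref Dom TyVar} (hη : ∀ k, (η k).IsPseudo) :
    ∀ k, (Exp.upSub η k).IsPseudo
  | 0 => trivial
  | k + 1 => (hη k).rename

theorem Exp.IsPseudo.subst {M : Exp Lev Flo Ref Dom TyVar} :
    ∀ {η : ℕ → Exp Lev Flo Ref Dom TyVar}, (∀ k, (η k).IsPseudo) → M.IsPseudo →
      (M.subst η).IsPseudo := by
  induction M with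
  | var k => intro η hη _; exact hη k
  | fix X ih => intro η hη h; exact ih (Exp.isPseudo_upSub hη) h
  | _ => intro η hη h; exact h

theorem Exp.isPseudo_single {X : Exp Lev Flo Ref Dom TyVar} (hX : X.IsPseudo) :
    ∀ k, (Exp.single X k).IsPseudo
  | 0 => hX
  | _ + 1 => trivial

theorem ECtx.not_isVal_fill {R : Exp Lev Flo Ref Dom TyVar} (hR : ¬ R.IsVal)
    (E : ECtx Lev Flo Ref Dom TyVar) : ¬ (E.fill R).IsVal := by
  cases E <;> first | exact hR | exact id

/-! ### Flow relation -/

section Flow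

variable [Lattice Lev] [BoundedOrder Lev] [Lattice Flo] [BoundedOrder Flo] [FlowSetting Lev Flo]

/-- From `cl F a ≤ cl G a ≤ cl G b`, applying `cl F` and using idempotence on the left and `cl G b ≤
b` on the right. Consequently a more permissive policy makes more levels visible. -/
theorem FlowLE.anti {F G : Flo} (hFG : F ≤ G) {a b : Lev} (h : FlowLE G a b) : FlowLE F a b := by
  unfold FlowLE at *
  calc FlowSetting.cl F a = FlowSetting.cl F (FlowSetting.cl F a) :=
        (FlowSetting.cl_idem F a).symm
    _ ≤ FlowSetting.cl F (FlowSetting.cl G b) :=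
        FlowSetting.cl_mono _ _ _ ((FlowSetting.cl_perm F G hFG a).trans h)
    _ ≤ FlowSetting.cl F b := FlowSetting.cl_mono _ _ _ (FlowSetting.cl_le _ _)

theorem FlowLE.mono {F : Flo} {a a' b b' : Lev} (ha : a' ≤ a) (hb : b ≤ b') (h : FlowLE F a b) :
    FlowLE F a' b' :=
  (FlowSetting.cl_mono _ _ _ ha).trans (h.trans (FlowSetting.cl_mono _ _ _ hb))

theorem FlowLE.of_le {F : Flo} {a b : Lev} (h : a ≤ b) : FlowLE F a b :=
  FlowSetting.cl_mono _ _ _ h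

/-- This is how a hidden level passes through a side condition of the type system: with `a` a
reading or termination effect and `b` a writing effect or reference level, `k` becomes a lower bound
for the writes. -/
theorem FlowLE.le_of_le_cl {F : Flo} {k a b : Lev} (h : FlowLE F a b)
    (hk : k ≤ FlowSetting.cl F a) : k ≤ b :=
  hk.trans (h.trans (FlowSetting.cl_le _ _))

theorem flowLE_top {a b : Lev} : FlowLE (⊤ : Flo) a b ↔ a ≤ b := by
  simp [FlowLE, FlowSetting.cl_top]

/-- By idempotence of the closure. It provides `cl F a` as the hidden level of a `HighPair`. -/
theorem not_cl_le_of_not_flowLE {F : Flo} {a b : Lev} (h : ¬ FlowLE F a b) :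
    ¬ FlowSetting.cl F a ≤ b := fun hc => h (by
  have := FlowSetting.cl_mono F _ _ hc
  rwa [FlowSetting.cl_idem] at this)

/-- Inclusion of security effects. -/
def Eff.Sub (s s' : Eff Lev) : Prop := s.r ≤ s'.r ∧ s'.w ≤ s.w ∧ s.t ≤ s'.t

/-- The least security effect. -/
def Eff.none : Eff Lev := ⟨⊥, ⊤, ⊥⟩

omit [BoundedOrder Lev] in
theorem Eff.Sub.refl (s : Eff Lev) : s.Sub s := ⟨le_rfl, le_rfl, le_rfl⟩

end Flow

/-! ### Typing -/

section Typing

variable [Lattice Lev] [BoundedOrder Lev] [Lattice Flo] [BoundedOrder Flo] [FlowSetting Lev Flo]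
  {Sg : Ref → Lev × Ty Lev Flo TyVar}

/-- The axioms for values and the rule for abstractions leave level, policy and effect free; only
`fix` passes them on to its body, which is again a pseudo-value. -/
theorem Typed.isPseudo_any {M : Exp Lev Flo Ref Dom TyVar} {j : Lev} {F : Flo}
    {Γ : Ctx Lev Flo TyVar} {s : Eff Lev} {τ : Ty Lev Flo TyVar} (h : Typed Sg j F Γ M s τ)
    (hM : M.IsPseudo) (j' : Lev) (F' : Flo) (s' : Eff Lev) : Typed Sg j' F' Γ M s' τ := by
  induction h with
  | nil => exact .nil ..
  | tt => exact .tt ..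
  | ff => exact .ff ..
  | loc => exact .loc ..
  | var _ _ _ _ _ _ hk => exact .var _ _ _ _ _ _ hk
  | abs _ _ _ _ _ _ _ _ _ _ h => exact .abs _ _ _ _ _ _ _ _ _ _ h
  | fix _ _ _ _ _ _ hX _ ih => exact .fix _ _ _ _ _ _ hX (ih hX)
  | _ => exact hM.elim

theorem Typed.isVal_any {M : Exp Lev Flo Ref Dom TyVar} {j : Lev} {F : Flo}
    {Γ : Ctx Lev Flo TyVar} {s : Eff Lev} {τ : Ty Lev Flo TyVar} (h : Typed Sg j F Γ M s τ)
    (hM : M.IsVal) (j' : Lev) (F' : Flo) (s' : Eff Lev) : Typed Sg j' F' Γ M s' τ :=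
  h.isPseudo_any hM.isPseudo j' F' s'

theorem Typed.rename {M : Exp Lev Flo Ref Dom TyVar} {j : Lev} {F : Flo}
    {Γ : Ctx Lev Flo TyVar} {s : Eff Lev} {τ : Ty Lev Flo TyVar} (h : Typed Sg j F Γ M s τ) :
    ∀ {Δ : Ctx Lev Flo TyVar} {ρ : ℕ → ℕ}, (∀ k θ, Γ k = some θ → Δ (ρ k) = some θ) →
      Typed Sg j F Δ (M.rename ρ) s τ := by
  have up : ∀ {Γ Δ : Ctx Lev Flo TyVar} {ρ : ℕ → ℕ} (σ : Ty Lev Flo TyVar),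
      (∀ k θ, Γ k = some θ → Δ (ρ k) = some θ) →
      ∀ k θ, Ctx.cons σ Γ k = some θ → Ctx.cons σ Δ (Exp.upRen ρ k) = some θ := by
    intro Γ Δ ρ σ h k θ hk
    cases k with
    | zero => exact hk
    | succ k => exact h k θ hk
  induction h with
  | nil => intros; exact .nil ..
  | tt => intros; exact .tt ..
  | ff => intros; exact .ff ..
  | loc => intros; exact .loc ..
  | var _ _ _ _ _ _ hk => intro Δ ρ h; exact .var _ _ _ _ _ _ (h _ _ hk)
  | abs _ _ _ _ _ _ _ _ _ _ _ ih => intro Δ ρ h; exact .abs _ _ _ _ _ _ _ _ _ _ (ih (up _ h))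
  | fix _ _ _ _ _ _ hX _ ih => intro Δ ρ h; exact .fix _ _ _ _ _ _ hX.rename (ih (up _ h))
  | app _ _ _ _ _ _ _ _ _ _ _ _ h₁ h₂ h₃ ihM ihN =>
    intro Δ ρ h; exact .app _ _ _ _ _ _ _ _ _ _ (ihM h) (ihN h) h₁ h₂ h₃
  | seq _ _ _ _ _ _ _ _ _ _ _ h₁ ihM ihN =>
    intro Δ ρ h; exact .seq _ _ _ _ _ _ _ _ _ (ihM h) (ihN h) h₁
  | newref _ _ _ _ _ _ _ _ h₁ h₂ ih =>
    intro Δ ρ h; exact .newref _ _ _ _ _ _ _ (ih h) h₁ h₂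
  | assign _ _ _ _ _ _ _ _ _ _ _ h₁ h₂ h₃ ihM ihN =>
    intro Δ ρ h; exact .assign _ _ _ _ _ _ _ _ _ (ihM h) (ihN h) h₁ h₂ h₃
  | deref _ _ _ _ _ _ _ _ ih => intro Δ ρ h; exact .deref _ _ _ _ _ _ _ (ih h)
  | cond _ _ _ _ _ _ _ _ _ _ _ _ _ h₁ h₂ ihM iht ihf =>
    intro Δ ρ h; exact .cond _ _ _ _ _ _ _ _ _ _ (ihM h) (iht h) (ihf h) h₁ h₂
  | allowed _ _ _ _ _ _ _ _ _ _ _ h₁ h₂ iht ihf =>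
    intro Δ ρ h; exact .allowed _ _ _ _ _ _ _ _ _ (iht h) (ihf h) h₁ h₂
  | flow _ _ _ _ _ _ _ _ ih => intro Δ ρ h; exact .flow _ _ _ _ _ _ _ (ih h)
  | mig _ _ _ _ _ _ _ _ ih => intro Δ ρ h; exact .mig _ _ _ _ _ _ _ (ih h)

/-- The substituted terms are typed at all levels, policies and effects because a variable may occur
below an abstraction, `flow` or `thread`, where these parameters change. They are pseudo-values so
that bodies of `fix` remain pseudo-values. -/
theorem Typed.subst {M : Exp Lev Flo Ref Dom TyVar} {j : Lev} {F : Flo}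
    {Γ : Ctx Lev Flo TyVar} {s : Eff Lev} {τ : Ty Lev Flo TyVar} (h : Typed Sg j F Γ M s τ) :
    ∀ {Δ : Ctx Lev Flo TyVar} {η : ℕ → Exp Lev Flo Ref Dom TyVar}, (∀ k, (η k).IsPseudo) →
      (∀ k θ, Γ k = some θ → ∀ j F s, Typed Sg j F Δ (η k) s θ) →
      Typed Sg j F Δ (M.subst η) s τ := by
  have up : ∀ {Γ Δ : Ctx Lev Flo TyVar} {η : ℕ → Exp Lev Flo Ref Dom TyVar}
      (σ : Ty Lev Flo TyVar),
      (∀ k θ, Γ k = some θ → ∀ j F s, Typed Sg j F Δ (η k) s θ) →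
      ∀ k θ, Ctx.cons σ Γ k = some θ →
        ∀ j F s, Typed Sg j F (Ctx.cons σ Δ) (Exp.upSub η k) s θ := by
    intro Γ Δ η σ h k θ hk j F s
    cases k with
    | zero => exact .var _ _ _ _ _ _ hk
    | succ k => exact (h k θ hk j F s).rename fun _ _ h => h
  induction h with
  | nil => intros; exact .nil ..
  | tt => intros; exact .tt ..
  | ff => intros; exact .ff ..
  | loc => intros; exact .loc ..
  | var _ _ _ _ _ _ hk => intro Δ η _ h; exact h _ _ hk _ _ _
  | abs _ _ _ _ _ _ _ _ _ _ _ ih =>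
    intro Δ η hη h; exact .abs _ _ _ _ _ _ _ _ _ _ (ih (Exp.isPseudo_upSub hη) (up _ h))
  | fix _ _ _ _ _ _ hX _ ih =>
    intro Δ η hη h
    exact .fix _ _ _ _ _ _ (hX.subst (Exp.isPseudo_upSub hη))
      (ih (Exp.isPseudo_upSub hη) (up _ h))
  | app _ _ _ _ _ _ _ _ _ _ _ _ h₁ h₂ h₃ ihM ihN =>
    intro Δ η hη h; exact .app _ _ _ _ _ _ _ _ _ _ (ihM hη h) (ihN hη h) h₁ h₂ h₃
  | seq _ _ _ _ _ _ _ _ _ _ _ h₁ ihM ihN =>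
    intro Δ η hη h; exact .seq _ _ _ _ _ _ _ _ _ (ihM hη h) (ihN hη h) h₁
  | newref _ _ _ _ _ _ _ _ h₁ h₂ ih =>
    intro Δ η hη h; exact .newref _ _ _ _ _ _ _ (ih hη h) h₁ h₂
  | assign _ _ _ _ _ _ _ _ _ _ _ h₁ h₂ h₃ ihM ihN =>
    intro Δ η hη h; exact .assign _ _ _ _ _ _ _ _ _ (ihM hη h) (ihN hη h) h₁ h₂ h₃
  | deref _ _ _ _ _ _ _ _ ih => intro Δ η hη h; exact .deref _ _ _ _ _ _ _ (ih hη h)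
  | cond _ _ _ _ _ _ _ _ _ _ _ _ _ h₁ h₂ ihM iht ihf =>
    intro Δ η hη h; exact .cond _ _ _ _ _ _ _ _ _ _ (ihM hη h) (iht hη h) (ihf hη h) h₁ h₂
  | allowed _ _ _ _ _ _ _ _ _ _ _ h₁ h₂ iht ihf =>
    intro Δ η hη h; exact .allowed _ _ _ _ _ _ _ _ _ (iht hη h) (ihf hη h) h₁ h₂
  | flow _ _ _ _ _ _ _ _ ih => intro Δ η hη h; exact .flow _ _ _ _ _ _ _ (ih hη h)
  | mig _ _ _ _ _ _ _ _ ih => intro Δ η hη h; exact .mig _ _ _ _ _ _ _ (ih hη h)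

theorem Typed.inst {M X : Exp Lev Flo Ref Dom TyVar} {j j' : Lev} {F F' : Flo}
    {Γ : Ctx Lev Flo TyVar} {s s' : Eff Lev} {τ σ : Ty Lev Flo TyVar}
    (h : Typed Sg j F (Ctx.cons τ Γ) M s σ) (hX : X.IsPseudo) (hT : Typed Sg j' F' Γ X s' τ) :
    Typed Sg j F Γ (Exp.inst X M) s σ := by
  refine h.subst (Exp.isPseudo_single hX) fun k θ hk j F s => ?_
  cases k with
  | zero => cases hk; exact hT.isPseudo_any hX _ _ _
  | succ k => exact .var _ _ _ _ _ _ hk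

/-- A typed redex in evaluation position has a writing effect at least that of the whole. -/
theorem Typed.of_fill {R : Exp Lev Flo Ref Dom TyVar} {j : Lev} {Γ : Ctx Lev Flo TyVar}
    (E : ECtx Lev Flo Ref Dom TyVar) :
    ∀ {F : Flo} {s : Eff Lev} {τ : Ty Lev Flo TyVar}, Typed Sg j F Γ (E.fill R) s τ →
      ∃ F' s' τ', Typed Sg j F' Γ R s' τ' ∧ s.w ≤ s'.w := by
  induction E with
  | hole => intro F s τ h; exact ⟨_, _, _, h, le_rfl⟩
  | appL E N ih =>
    intro F s τ h
    cases h with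
    | app _ _ _ _ _ _ _ _ _ _ hM hN h₁ h₂ h₃ =>
      obtain ⟨F', s', τ', h, hw⟩ := ih hM
      exact ⟨F', s', τ', h, (inf_le_left.trans (inf_le_left.trans inf_le_left)).trans hw⟩
  | appR V E ih =>
    intro F s τ h
    cases h with
    | app _ _ _ _ _ _ _ _ _ _ hM hN h₁ h₂ h₃ =>
      obtain ⟨F', s', τ', h, hw⟩ := ih hN
      exact ⟨F', s', τ', h, (inf_le_left.trans inf_le_right).trans hw⟩
  | seq E N ih =>
    intro F s τ h
    cases h with
    | seq _ _ _ _ _ _ _ _ _ hM hN h₁ =>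
      obtain ⟨F', s', τ', h, hw⟩ := ih hM
      exact ⟨F', s', τ', h, inf_le_left.trans hw⟩
  | newref l θ E ih =>
    intro F s τ h
    cases h with
    | newref _ _ _ _ _ _ _ hM h₁ h₂ =>
      obtain ⟨F', s', τ', h, hw⟩ := ih hM
      exact ⟨F', s', τ', h, inf_le_left.trans hw⟩
  | deref E ih =>
    intro F s τ h
    cases h with
    | deref _ _ _ _ _ _ _ hM =>
      obtain ⟨F', s', τ', h, hw⟩ := ih hM
      exact ⟨F', s', τ', h, inf_le_left.trans hw⟩
  | assignL E N ih =>
    intro F s τ h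
    cases h with
    | assign _ _ _ _ _ _ _ _ _ hM hN h₁ h₂ h₃ =>
      obtain ⟨F', s', τ', h, hw⟩ := ih hM
      exact ⟨F', s', τ', h, (inf_le_left.trans inf_le_left).trans hw⟩
  | assignR V E ih =>
    intro F s τ h
    cases h with
    | assign _ _ _ _ _ _ _ _ _ hM hN h₁ h₂ h₃ =>
      obtain ⟨F', s', τ', h, hw⟩ := ih hN
      exact ⟨F', s', τ', h, (inf_le_left.trans inf_le_right).trans hw⟩
  | cond E Nt Nf ih =>
    intro F s τ h
    cases h with
    | cond _ _ _ _ _ _ _ _ _ _ hM ht hf h₁ h₂ =>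
      obtain ⟨F', s', τ', h, hw⟩ := ih hM
      exact ⟨F', s', τ', h, (inf_le_left.trans (inf_le_left.trans inf_le_left)).trans hw⟩
  | flow G E ih =>
    intro F s τ h
    cases h with
    | flow _ _ _ _ _ _ _ hN => exact ih hN

omit [BoundedOrder Lev] in
theorem Eff.Sub.join {s₁ s₂ s₁' s₂' : Eff Lev} (h₁ : s₁.Sub s₁') (h₂ : s₂.Sub s₂') :
    (s₁.join s₂).Sub (s₁'.join s₂') :=
  ⟨sup_le_sup h₁.1 h₂.1, inf_le_inf h₁.2.1 h₂.2.1, sup_le_sup h₁.2.2 h₂.2.2⟩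

/-- Serves the summand that application and conditional add to the termination effect. -/
theorem Eff.Sub.term {a b : Lev} (h : a ≤ b) : (⟨⊥, ⊤, a⟩ : Eff Lev).Sub ⟨⊥, ⊤, b⟩ :=
  ⟨le_rfl, le_rfl, h⟩

/-- Replacement of the redex of a typed expression by an expression with smaller effects. -/
theorem Typed.fill_mono {R R' : Exp Lev Flo Ref Dom TyVar} {j : Lev} {Γ : Ctx Lev Flo TyVar}
    (hR : ∀ F s τ, Typed Sg j F Γ R s τ → ∃ s', s'.Sub s ∧ Typed Sg j F Γ R' s' τ)
    (E : ECtx Lev Flo Ref Dom TyVar) :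
    ∀ {F : Flo} {s : Eff Lev} {τ : Ty Lev Flo TyVar}, Typed Sg j F Γ (E.fill R) s τ →
      ∃ s', s'.Sub s ∧ Typed Sg j F Γ (E.fill R') s' τ := by
  induction E with
  | hole => intro F s τ h; exact hR _ _ _ h
  | appL E N ih =>
    intro F s τ h
    cases h with
    | app _ _ _ s₁ s₂ s₃ _ _ _ _ hM hN h₁ h₂ h₃ =>
      obtain ⟨s', hs, h⟩ := ih hM
      exact ⟨_, ((hs.join (.refl s₂)).join (.refl s₃)).join
        (.term (sup_le_sup hs.1 le_rfl)),
        .app _ _ _ _ _ _ _ _ _ _ h hN (h₁.mono hs.2.2 le_rfl) (h₂.mono hs.1 le_rfl) h₃⟩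
  | appR V E ih =>
    intro F s τ h
    cases h with
    | app _ _ _ s₁ s₂ s₃ _ _ _ _ hM hN h₁ h₂ h₃ =>
      obtain ⟨s', hs, h⟩ := ih hN
      exact ⟨_, (Eff.Sub.join (.refl _) hs).join (.term (sup_le_sup le_rfl hs.1)),
        .app _ _ _ _ _ _ _ _ _ _ hM h (h₁.mono le_rfl hs.2.1) h₂ (h₃.mono hs.1 le_rfl)⟩
  | seq E N ih =>
    intro F s τ h
    cases h with
    | seq _ _ _ _ _ _ _ _ _ hM hN h₁ =>
      obtain ⟨s', hs, h⟩ := ih hM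
      exact ⟨_, hs.join (.refl _), .seq _ _ _ _ _ _ _ _ _ h hN (h₁.mono hs.2.2 le_rfl)⟩
  | newref l θ E ih =>
    intro F s τ h
    cases h with
    | newref _ _ _ _ _ _ _ hM h₁ h₂ =>
      obtain ⟨s', hs, h⟩ := ih hM
      exact ⟨_, hs.join (.refl _), .newref _ _ _ _ _ _ _ h (h₁.mono hs.1 le_rfl)
        (h₂.mono hs.2.2 le_rfl)⟩
  | deref E ih =>
    intro F s τ h
    cases h with
    | deref _ _ _ _ _ _ _ hM =>
      obtain ⟨s', hs, h⟩ := ih hM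
      exact ⟨_, hs.join (.refl _), .deref _ _ _ _ _ _ _ h⟩
  | assignL E N ih =>
    intro F s τ h
    cases h with
    | assign _ _ _ _ _ _ _ _ _ hM hN h₁ h₂ h₃ =>
      obtain ⟨s', hs, h⟩ := ih hM
      exact ⟨_, (hs.join (.refl _)).join (.refl _), .assign _ _ _ _ _ _ _ _ _ h hN
        (h₁.mono hs.2.2 le_rfl) (h₂.mono hs.1 le_rfl) h₃⟩
  | assignR V E ih =>
    intro F s τ h
    cases h with
    | assign _ _ _ _ _ _ _ _ _ hM hN h₁ h₂ h₃ =>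
      obtain ⟨s', hs, h⟩ := ih hN
      exact ⟨_, (Eff.Sub.join (.refl _) hs).join (.refl _), .assign _ _ _ _ _ _ _ _ _ hM h
        (h₁.mono le_rfl hs.2.1) h₂ (h₃.mono hs.1 le_rfl)⟩
  | cond E Nt Nf ih =>
    intro F s τ h
    cases h with
    | cond _ _ _ _ s₁ s₂ _ _ _ _ hM ht hf h₁ h₂ =>
      obtain ⟨s', hs, h⟩ := ih hM
      exact ⟨_, ((hs.join (.refl s₁)).join (.refl s₂)).join (.term hs.1),
        .cond _ _ _ _ _ _ _ _ _ _ h ht hf (h₁.mono hs.1 le_rfl) (h₂.mono hs.1 le_rfl)⟩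
  | flow G E ih =>
    intro F s τ h
    cases h with
    | flow _ _ _ _ _ _ _ hN =>
      obtain ⟨s', hs, h⟩ := ih hN
      exact ⟨s', hs, .flow _ _ _ _ _ _ _ h⟩

theorem Compatible.update [DecidableEq Ref] {Γ : Ctx Lev Flo TyVar}
    {S : Store Lev Flo Ref Dom TyVar} (hS : Compatible Sg Γ S) {a : Ref}
    {V : Val Lev Flo Ref Dom TyVar} {j : Lev} {F : Flo} {s : Eff Lev}
    (hV : Typed Sg j F Γ V.1 s (Sg a).2) : Compatible Sg Γ (Function.update S a (some V)) := by
  intro b U hb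
  by_cases h : b = a
  · subst h
    rw [Function.update_self] at hb
    cases hb
    exact hV.isVal_any V.2
  · rw [Function.update_of_ne h] at hb
    exact hS b U hb

/-! ### Subject reduction and the visible effects of a redex. -/

section Reduction

variable [DecidableEq Ref] [DecidableEq Nam] {W : Dom → Option Flo} {Up : Nam → Lev}
  {T T' : Tracker Nam Dom} {m : Nam} {S S' : Store Lev Flo Ref Dom TyVar}
  {R R' : Exp Lev Flo Ref Dom TyVar} {new : Option (Nam × Exp Lev Flo Ref Dom TyVar)}

omit [FlowSetting Lev Flo] [Lattice Lev] [BoundedOrder Lev] [BoundedOrder Flo] in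
theorem Redex.not_isVal (h : Redex W Sg Up T m S R T' R' new S') : ¬ R.IsVal := by
  cases h <;> exact id

omit [FlowSetting Lev Flo] [Lattice Lev] [BoundedOrder Lev] [BoundedOrder Flo] in
theorem Redex.fresh (h : Redex W Sg Up T m S R T' R' new S') {n : Nam}
    {N : Exp Lev Flo Ref Dom TyVar} (hn : new = some (n, N)) : n ∉ pdom T ∧ n ∈ pdom T' := by
  cases h <;> cases hn
  rename_i hn _
  exact ⟨hn, by simp [pdom]⟩

/-- Effects can only shrink: the effect of a redex is a join that contains the effects of its
branches and, for an application, the latent effect of the function. Results that are values can be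
given the effect of the redex; for a dereferencing this uses compatibility of the store. -/
theorem Redex.typed {Γ : Ctx Lev Flo TyVar} {j : Lev} {F : Flo} {s : Eff Lev}
    {τ : Ty Lev Flo TyVar} (h : Redex W Sg Up T m S R T' R' new S') (hS : Compatible Sg Γ S)
    (hT : Typed Sg j F Γ R s τ) : ∃ s', s'.Sub s ∧ Typed Sg j F Γ R' s' τ := by
  cases h with
  | beta M V hV =>
    cases hT with
    | app _ _ _ s₁ s₂ s₃ _ _ _ _ hM hN h₁ h₂ h₃ =>
      cases hM with
      | abs _ _ _ _ _ _ _ _ _ _ hM =>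
        refine ⟨_, ⟨?_, ?_, ?_⟩, hM.inst hV.isPseudo hN⟩
        · exact le_sup_of_le_left (le_sup_of_le_left le_sup_right)
        · exact inf_le_of_left_le (inf_le_of_left_le inf_le_right)
        · exact le_sup_of_le_left (le_sup_of_le_left le_sup_right)
  | condTrue Nt Nf =>
    cases hT with
    | cond _ _ _ _ s₁ s₂ _ _ _ _ hM ht hf h₁ h₂ =>
      refine ⟨_, ⟨?_, ?_, ?_⟩, ht⟩
      · exact le_sup_of_le_left (le_sup_of_le_left le_sup_right)
      · exact inf_le_of_left_le (inf_le_of_left_le inf_le_right)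
      · exact le_sup_of_le_left (le_sup_of_le_left le_sup_right)
  | condFalse Nt Nf =>
    cases hT with
    | cond _ _ _ _ s₁ s₂ _ _ _ _ hM ht hf h₁ h₂ =>
      refine ⟨_, ⟨?_, ?_, ?_⟩, hf⟩
      · exact le_sup_of_le_left le_sup_right
      · exact inf_le_of_left_le inf_le_right
      · exact le_sup_of_le_left le_sup_right
  | seq V N hV =>
    cases hT with
    | seq _ _ _ _ _ _ _ _ _ hM hN h₁ => exact ⟨_, ⟨le_sup_right, inf_le_right, le_sup_right⟩, hN⟩
  | fix X hX =>
    have h' := hT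
    cases hT with
    | fix _ _ _ _ _ _ _ h => exact ⟨_, .refl _, h.inst (X := .fix X) hX h'⟩
  | flow G V hV =>
    cases hT with
    | flow _ _ _ _ _ _ _ hN => exact ⟨_, .refl s, hN.isVal_any hV _ _ _⟩
  | deref a V ha =>
    cases hT with
    | deref _ _ _ _ _ _ _ hM =>
      cases hM
      exact ⟨_, .refl _, hS a V ha _ _ _⟩
  | assign a V =>
    cases hT
    exact ⟨_, .refl _, .nil ..⟩
  | newref l θ V a ha hl =>
    cases hT
    rename_i s₁ _ _ _
    refine ⟨s₁.join ⟨⊥, l, ⊥⟩, .refl _, ?_⟩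
    have := Typed.loc (Sg := Sg) (Dom := Dom) j F Γ (s₁.join ⟨⊥, l, ⊥⟩) a
    rwa [hl] at this
  | allowedTrue F Nt Nf d A hd hA hF =>
    cases hT with
    | allowed _ _ _ _ _ _ _ _ _ ht hf h₁ h₂ =>
      exact ⟨_, ⟨le_sup_of_le_left le_sup_left, inf_le_of_left_le inf_le_left,
        le_sup_of_le_left le_sup_left⟩, ht⟩
  | allowedFalse F Nt Nf d A hd hA hF =>
    cases hT with
    | allowed _ _ _ _ _ _ _ _ _ ht hf h₁ h₂ =>
      exact ⟨_, ⟨le_sup_of_le_left le_sup_right, inf_le_of_left_le inf_le_right,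
        le_sup_of_le_left le_sup_right⟩, hf⟩
  | thread l N d n hn hl =>
    cases hT
    exact ⟨_, .refl _, .nil ..⟩

theorem Redex.compatible {Γ : Ctx Lev Flo TyVar} {j : Lev} {F : Flo} {s : Eff Lev}
    {τ : Ty Lev Flo TyVar} (h : Redex W Sg Up T m S R T' R' new S') (hS : Compatible Sg Γ S)
    (hT : Typed Sg j F Γ R s τ) : Compatible Sg Γ S' := by
  cases h with
  | assign a V =>
    cases hT with
    | assign _ _ _ _ _ _ _ _ _ hM hN h₁ h₂ h₃ =>
      cases hM
      exact hS.update hN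
  | newref l θ V a ha hl =>
    cases hT with
    | newref _ _ _ _ _ _ _ hM h₁ h₂ => exact hS.update (a := a) (by rw [hl]; exact hM)
  | _ => exact hS

/-- The body of `thread` is typed at the annotated level and under `⊤`, and the name chosen for the
new thread has exactly that level. -/
theorem Redex.typed_new {Γ : Ctx Lev Flo TyVar} {j : Lev} {F : Flo} {s : Eff Lev}
    {τ : Ty Lev Flo TyVar} (h : Redex W Sg Up T m S R T' R' new S')
    (hT : Typed Sg j F Γ R s τ) {n : Nam} {N : Exp Lev Flo Ref Dom TyVar}
    (hn : new = some (n, N)) :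
    ∃ s', Typed Sg (Up n) (⊤ : Flo) Γ N s' .unit ∧ s.w ≤ s'.w := by
  cases h <;> cases hn
  rename_i hl
  subst hl
  cases hT with
  | mig _ _ _ _ _ _ _ hM => exact ⟨_, hM, inf_le_right⟩

/-- The level of an updated reference and that of a created thread both bound the writing effect
from above, so neither can be visible. -/
theorem Redex.lowEqState_of_high {Γ : Ctx Lev Flo TyVar} {j ℓ : Lev} {F : Flo} {s : Eff Lev}
    {τ : Ty Lev Flo TyVar} (h : Redex W Sg Up T m S R T' R' new S')
    (hT : Typed Sg j F Γ R s τ) (hw : ¬ s.w ≤ ℓ) :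
    LowEqState Sg Up (⊤ : Flo) ℓ T' S' T S := by
  have upS : ∀ (a : Ref) (V : Val Lev Flo Ref Dom TyVar), ¬ (Sg a).1 ≤ ℓ →
      LowEqStore Sg (⊤ : Flo) ℓ (Function.update S a (some V)) S := by
    intro a V ha b hb
    rw [Function.update_of_ne]
    rintro rfl
    exact ha (flowLE_top.1 hb)
  cases h with
  | assign a V =>
    cases hT with
    | assign _ _ _ _ _ _ _ _ _ hM hN h₁ h₂ h₃ =>
      cases hM
      exact ⟨upS a V fun h => hw (inf_le_right.trans h), fun _ _ => rfl⟩
  | newref l θ V a ha hl =>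
    cases hT with
    | newref _ _ _ _ _ _ _ hM h₁ h₂ =>
      exact ⟨upS a V fun h => hw (inf_le_right.trans (by rwa [hl] at h)), fun _ _ => rfl⟩
  | thread l N d n hn hl =>
    cases hT with
    | mig _ _ _ _ _ _ _ hM =>
      refine ⟨fun _ _ => rfl, fun n' h' => ?_⟩
      rw [Function.update_of_ne]
      rintro rfl
      exact hw (inf_le_left.trans (hl ▸ flowLE_top.1 h'))
  | _ => exact ⟨fun _ _ => rfl, fun _ _ => rfl⟩

end Reduction

end Typing

/-! ### The lockstep relation -/

section Lockstep

variable [Lattice Lev] [BoundedOrder Lev] [Lattice Flo] [BoundedOrder Flo] [FlowSetting Lev Flo]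

/-- Expressions that are typed with an effect included in `b`. -/
def TypedLE (Sg : Ref → Lev × Ty Lev Flo TyVar) (Γ : Ctx Lev Flo TyVar) (j : Lev) (F : Flo)
    (M : Exp Lev Flo Ref Dom TyVar) (b : Eff Lev) (τ : Ty Lev Flo TyVar) : Prop :=
  ∃ s, s.Sub b ∧ Typed Sg j F Γ M s τ

/-- Pairs of expressions that write only above some level `k` that is not visible at `ℓ`, where
`k` is accounted for by the reading effect `r` and the termination effect `t`. -/
def HighPair (Sg : Ref → Lev × Ty Lev Flo TyVar) (Γ : Ctx Lev Flo TyVar) (ℓ j : Lev) (F : Flo)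
    (M₁ M₂ : Exp Lev Flo Ref Dom TyVar) (r t : Lev) (τ : Ty Lev Flo TyVar) : Prop :=
  ∃ k, ¬ k ≤ ℓ ∧ k ≤ FlowSetting.cl F r ∧ k ≤ FlowSetting.cl F t ∧
    TypedLE Sg Γ j F M₁ ⟨r, k, t⟩ τ ∧ TypedLE Sg Γ j F M₂ ⟨r, k, t⟩ τ

/-- Pairs of values that may differ only if the reading effect `r` is not visible at `ℓ`. -/
structure ValPair (Sg : Ref → Lev × Ty Lev Flo TyVar) (Γ : Ctx Lev Flo TyVar) (ℓ : Lev) (F : Flo)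
    (V₁ V₂ : Exp Lev Flo Ref Dom TyVar) (r : Lev) (τ : Ty Lev Flo TyVar) : Prop where
  val₁ : V₁.IsVal
  val₂ : V₂.IsVal
  typed₁ : ∀ j F s, Typed Sg j F Γ V₁ s τ
  typed₂ : ∀ j F s, Typed Sg j F Γ V₂ s τ
  eq_or : V₁ = V₂ ∨ ¬ FlowSetting.cl F r ≤ ℓ

/-- Pairs of typed expressions that are to be executed in lockstep, until control depends on
information that is not visible at `ℓ`. The levels `r` and `t` bound the reading and termination
effects. -/
inductive Lockstep (Sg : Ref → Lev × Ty Lev Flo TyVar) (Γ : Ctx Lev Flo TyVar) (ℓ j : Lev) :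
    Flo → Exp Lev Flo Ref Dom TyVar → Exp Lev Flo Ref Dom TyVar → Lev → Lev →
      Ty Lev Flo TyVar → Prop where
  | refl {F M s τ r t} (hM : Typed Sg j F Γ M s τ) (hr : s.r ≤ r) (ht : s.t ≤ t) :
      Lockstep Sg Γ ℓ j F M M r t τ
  | high {F M₁ M₂ r t τ} (h : HighPair Sg Γ ℓ j F M₁ M₂ r t τ) :
      Lockstep Sg Γ ℓ j F M₁ M₂ r t τ
  | val {F V₁ V₂ r t τ} (h : ValPair Sg Γ ℓ F V₁ V₂ r τ) : Lockstep Sg Γ ℓ j F V₁ V₂ r t τ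
  | appL {F M₁ M₂ N r₀ t₀ s' s'' τ σ r t} (hM : Lockstep Sg Γ ℓ j F M₁ M₂ r₀ t₀ (.fn τ j F s' σ))
      (hN : Typed Sg j F Γ N s'' τ) (h₁ : FlowLE F t₀ s''.w) (h₂ : FlowLE F r₀ s'.w)
      (h₃ : FlowLE F s''.r s'.w) (hr : (r₀ ⊔ s'.r) ⊔ s''.r ≤ r)
      (ht : ((t₀ ⊔ s'.t) ⊔ s''.t) ⊔ (r₀ ⊔ s''.r) ≤ t) :
      Lockstep Sg Γ ℓ j F (.app M₁ N) (.app M₂ N) r t σ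
  | appR {F V₁ V₂ N₁ N₂ r₀ r₁ t₁ s' τ σ r t} (hV : ValPair Sg Γ ℓ F V₁ V₂ r₀ (.fn τ j F s' σ))
      (hN : Lockstep Sg Γ ℓ j F N₁ N₂ r₁ t₁ τ) (h₂ : FlowLE F r₀ s'.w) (h₃ : FlowLE F r₁ s'.w)
      (hr : (r₀ ⊔ s'.r) ⊔ r₁ ≤ r) (ht : (s'.t ⊔ t₁) ⊔ (r₀ ⊔ r₁) ≤ t) :
      Lockstep Sg Γ ℓ j F (.app V₁ N₁) (.app V₂ N₂) r t σ
  | seq {F M₁ M₂ N r₀ t₀ s' τ σ r t} (hM : Lockstep Sg Γ ℓ j F M₁ M₂ r₀ t₀ τ)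
      (hN : Typed Sg j F Γ N s' σ) (h₁ : FlowLE F t₀ s'.w) (hr : r₀ ⊔ s'.r ≤ r)
      (ht : t₀ ⊔ s'.t ≤ t) : Lockstep Sg Γ ℓ j F (.seq M₁ N) (.seq M₂ N) r t σ
  | newref {F M₁ M₂ r₀ t₀ l θ r t} (hM : Lockstep Sg Γ ℓ j F M₁ M₂ r₀ t₀ θ)
      (h₁ : FlowLE F r₀ l) (h₂ : FlowLE F t₀ l) (hr : r₀ ≤ r) (ht : t₀ ≤ t) :
      Lockstep Sg Γ ℓ j F (.newref l θ M₁) (.newref l θ M₂) r t (.ref θ l)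
  | deref {F M₁ M₂ r₀ t₀ l θ r t} (hM : Lockstep Sg Γ ℓ j F M₁ M₂ r₀ t₀ (.ref θ l))
      (hr : r₀ ⊔ l ≤ r) (ht : t₀ ≤ t) : Lockstep Sg Γ ℓ j F (.deref M₁) (.deref M₂) r t θ
  | assignL {F M₁ M₂ N r₀ t₀ s' l θ r t} (hM : Lockstep Sg Γ ℓ j F M₁ M₂ r₀ t₀ (.ref θ l))
      (hN : Typed Sg j F Γ N s' θ) (h₁ : FlowLE F t₀ s'.w) (h₂ : FlowLE F r₀ l)
      (h₃ : FlowLE F s'.r l) (hr : r₀ ⊔ s'.r ≤ r) (ht : t₀ ⊔ s'.t ≤ t) :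
      Lockstep Sg Γ ℓ j F (.assign M₁ N) (.assign M₂ N) r t .unit
  | assignR {F V₁ V₂ N₁ N₂ r₀ r₁ t₁ l θ r t} (hV : ValPair Sg Γ ℓ F V₁ V₂ r₀ (.ref θ l))
      (hN : Lockstep Sg Γ ℓ j F N₁ N₂ r₁ t₁ θ) (h₂ : FlowLE F r₀ l) (h₃ : FlowLE F r₁ l)
      (hr : r₀ ⊔ r₁ ≤ r) (ht : t₁ ≤ t) :
      Lockstep Sg Γ ℓ j F (.assign V₁ N₁) (.assign V₂ N₂) r t .unit
  | cond {F M₁ M₂ Nt Nf r₀ t₀ st sf τ r t} (hM : Lockstep Sg Γ ℓ j F M₁ M₂ r₀ t₀ .bool)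
      (hNt : Typed Sg j F Γ Nt st τ) (hNf : Typed Sg j F Γ Nf sf τ) (h₁ : FlowLE F r₀ st.w)
      (h₂ : FlowLE F r₀ sf.w) (hr : (r₀ ⊔ st.r) ⊔ sf.r ≤ r)
      (ht : ((t₀ ⊔ st.t) ⊔ sf.t) ⊔ r₀ ≤ t) :
      Lockstep Sg Γ ℓ j F (.cond M₁ Nt Nf) (.cond M₂ Nt Nf) r t τ
  | flow {F G M₁ M₂ r t τ} (hM : Lockstep Sg Γ ℓ j (F ⊓ G) M₁ M₂ r t τ) :
      Lockstep Sg Γ ℓ j F (.flow G M₁) (.flow G M₂) r t τ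

variable {Sg : Ref → Lev × Ty Lev Flo TyVar} {Γ : Ctx Lev Flo TyVar} {ℓ j : Lev} {F : Flo}

theorem HighPair.symm {M₁ M₂ : Exp Lev Flo Ref Dom TyVar} {r t : Lev} {τ : Ty Lev Flo TyVar}
    (h : HighPair Sg Γ ℓ j F M₁ M₂ r t τ) : HighPair Sg Γ ℓ j F M₂ M₁ r t τ :=
  let ⟨k, hk, hr, ht, h₁, h₂⟩ := h
  ⟨k, hk, hr, ht, h₂, h₁⟩

theorem ValPair.symm {V₁ V₂ : Exp Lev Flo Ref Dom TyVar} {r : Lev} {τ : Ty Lev Flo TyVar}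
    (h : ValPair Sg Γ ℓ F V₁ V₂ r τ) : ValPair Sg Γ ℓ F V₂ V₁ r τ :=
  ⟨h.val₂, h.val₁, h.typed₂, h.typed₁, h.eq_or.imp_left Eq.symm⟩

theorem Lockstep.symm {M₁ M₂ : Exp Lev Flo Ref Dom TyVar} {r t : Lev} {τ : Ty Lev Flo TyVar}
    (h : Lockstep Sg Γ ℓ j F M₁ M₂ r t τ) : Lockstep Sg Γ ℓ j F M₂ M₁ r t τ := by
  induction h with
  | refl hM hr ht => exact .refl hM hr ht
  | high h => exact .high h.symm
  | val h => exact .val h.symm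
  | appL _ hN h₁ h₂ h₃ hr ht ih => exact .appL ih hN h₁ h₂ h₃ hr ht
  | appR hV _ h₂ h₃ hr ht ih => exact .appR hV.symm ih h₂ h₃ hr ht
  | seq _ hN h₁ hr ht ih => exact .seq ih hN h₁ hr ht
  | newref _ h₁ h₂ hr ht ih => exact .newref ih h₁ h₂ hr ht
  | deref _ hr ht ih => exact .deref ih hr ht
  | assignL _ hN h₁ h₂ h₃ hr ht ih => exact .assignL ih hN h₁ h₂ h₃ hr ht
  | assignR hV _ h₂ h₃ hr ht ih => exact .assignR hV.symm ih h₂ h₃ hr ht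
  | cond _ hNt hNf h₁ h₂ hr ht ih => exact .cond ih hNt hNf h₁ h₂ hr ht
  | flow _ ih => exact .flow ih

theorem ValPair.refl {V : Exp Lev Flo Ref Dom TyVar} (hV : V.IsVal) {j : Lev} {F' : Flo}
    {s : Eff Lev} {τ : Ty Lev Flo TyVar} (h : Typed Sg j F' Γ V s τ) (r : Lev) :
    ValPair Sg Γ ℓ F V V r τ :=
  ⟨hV, hV, h.isVal_any hV, h.isVal_any hV, .inl rfl⟩

theorem le_cl_mono {k a b : Lev} (hk : k ≤ FlowSetting.cl F a) (h : a ≤ b) :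
    k ≤ FlowSetting.cl F b :=
  hk.trans (FlowSetting.cl_mono _ _ _ h)

theorem flowLE_bot (b : Lev) : FlowLE F ⊥ b := FlowLE.of_le bot_le

/-! ### Typing rules with bounded effects. -/

omit [BoundedOrder Lev] [FlowSetting Lev Flo] [Lattice Flo] [BoundedOrder Flo] in
theorem Eff.Sub.trans {s s' s'' : Eff Lev} (h : s.Sub s') (h' : s'.Sub s'') : s.Sub s'' :=
  ⟨h.1.trans h'.1, h'.2.1.trans h.2.1, h.2.2.trans h'.2.2⟩

theorem TypedLE.mono {M : Exp Lev Flo Ref Dom TyVar} {b b' : Eff Lev} {τ : Ty Lev Flo TyVar}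
    (h : TypedLE Sg Γ j F M b τ) (hb : b.Sub b') : TypedLE Sg Γ j F M b' τ :=
  let ⟨s, hs, hM⟩ := h
  ⟨s, hs.trans hb, hM⟩

theorem Typed.typedLE {M : Exp Lev Flo Ref Dom TyVar} {s : Eff Lev} {τ : Ty Lev Flo TyVar}
    (h : Typed Sg j F Γ M s τ) : TypedLE Sg Γ j F M s τ := ⟨s, .refl s, h⟩

/-- The side conditions are preserved when reading and termination effects shrink and writing
effects grow, so it suffices to check them on the bounds. Working with bounds gives both members of
a high pair one common effect. -/
theorem TypedLE.app {M N : Exp Lev Flo Ref Dom TyVar} {b₁ b₂ s b : Eff Lev}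
    {τ σ : Ty Lev Flo TyVar} (hM : TypedLE Sg Γ j F M b₁ (.fn τ j F s σ))
    (hN : TypedLE Sg Γ j F N b₂ τ) (h₁ : FlowLE F b₁.t b₂.w) (h₂ : FlowLE F b₁.r s.w)
    (h₃ : FlowLE F b₂.r s.w) (hr : (b₁.r ⊔ s.r) ⊔ b₂.r ≤ b.r) (hw : b.w ≤ (b₁.w ⊓ s.w) ⊓ b₂.w)
    (ht : ((b₁.t ⊔ s.t) ⊔ b₂.t) ⊔ (b₁.r ⊔ b₂.r) ≤ b.t) :
    TypedLE Sg Γ j F (.app M N) b σ := by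
  obtain ⟨s₁, hs₁, hM⟩ := hM
  obtain ⟨s₂, hs₂, hN⟩ := hN
  refine ⟨_, .trans (.join (.join (.join hs₁ (.refl s)) hs₂) (.term (sup_le_sup hs₁.1 hs₂.1))) ?_,
    .app _ _ _ _ _ _ _ _ _ _ hM hN (h₁.mono hs₁.2.2 hs₂.2.1) (h₂.mono hs₁.1 le_rfl)
      (h₃.mono hs₂.1 le_rfl)⟩
  exact ⟨by simpa [Eff.join] using hr, by simpa [Eff.join] using hw, ht⟩

theorem TypedLE.seq {M N : Exp Lev Flo Ref Dom TyVar} {b₁ b₂ b : Eff Lev}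
    {τ σ : Ty Lev Flo TyVar} (hM : TypedLE Sg Γ j F M b₁ τ) (hN : TypedLE Sg Γ j F N b₂ σ)
    (h₁ : FlowLE F b₁.t b₂.w) (hr : b₁.r ⊔ b₂.r ≤ b.r) (hw : b.w ≤ b₁.w ⊓ b₂.w)
    (ht : b₁.t ⊔ b₂.t ≤ b.t) : TypedLE Sg Γ j F (.seq M N) b σ := by
  obtain ⟨s₁, hs₁, hM⟩ := hM
  obtain ⟨s₂, hs₂, hN⟩ := hN
  exact ⟨_, .trans (.join hs₁ hs₂) ⟨hr, hw, ht⟩,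
    .seq _ _ _ _ _ _ _ _ _ hM hN (h₁.mono hs₁.2.2 hs₂.2.1)⟩

theorem TypedLE.newref {M : Exp Lev Flo Ref Dom TyVar} {b₁ b : Eff Lev} {l : Lev}
    {θ : Ty Lev Flo TyVar} (hM : TypedLE Sg Γ j F M b₁ θ) (h₁ : FlowLE F b₁.r l)
    (h₂ : FlowLE F b₁.t l) (hr : b₁.r ≤ b.r) (hw : b.w ≤ b₁.w ⊓ l) (ht : b₁.t ≤ b.t) :
    TypedLE Sg Γ j F (.newref l θ M) b (.ref θ l) := by
  obtain ⟨s₁, hs₁, hM⟩ := hM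
  refine ⟨_, .trans (.join hs₁ (.refl _)) ?_,
    .newref _ _ _ _ _ _ _ hM (h₁.mono hs₁.1 le_rfl) (h₂.mono hs₁.2.2 le_rfl)⟩
  exact ⟨by simpa [Eff.join] using hr, hw, by simpa [Eff.join] using ht⟩

theorem TypedLE.deref {M : Exp Lev Flo Ref Dom TyVar} {b₁ b : Eff Lev} {l : Lev}
    {θ : Ty Lev Flo TyVar} (hM : TypedLE Sg Γ j F M b₁ (.ref θ l)) (hr : b₁.r ⊔ l ≤ b.r)
    (hw : b.w ≤ b₁.w) (ht : b₁.t ≤ b.t) : TypedLE Sg Γ j F (.deref M) b θ := by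
  obtain ⟨s₁, hs₁, hM⟩ := hM
  refine ⟨_, .trans (.join hs₁ (.refl _)) ?_, .deref _ _ _ _ _ _ _ hM⟩
  exact ⟨hr, by simpa [Eff.join] using hw, by simpa [Eff.join] using ht⟩

theorem TypedLE.assign {M N : Exp Lev Flo Ref Dom TyVar} {b₁ b₂ b : Eff Lev} {l : Lev}
    {θ : Ty Lev Flo TyVar} (hM : TypedLE Sg Γ j F M b₁ (.ref θ l))
    (hN : TypedLE Sg Γ j F N b₂ θ) (h₁ : FlowLE F b₁.t b₂.w) (h₂ : FlowLE F b₁.r l)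
    (h₃ : FlowLE F b₂.r l) (hr : b₁.r ⊔ b₂.r ≤ b.r) (hw : b.w ≤ (b₁.w ⊓ b₂.w) ⊓ l)
    (ht : b₁.t ⊔ b₂.t ≤ b.t) : TypedLE Sg Γ j F (.assign M N) b .unit := by
  obtain ⟨s₁, hs₁, hM⟩ := hM
  obtain ⟨s₂, hs₂, hN⟩ := hN
  refine ⟨_, .trans (.join (.join hs₁ hs₂) (.refl _)) ?_,
    .assign _ _ _ _ _ _ _ _ _ hM hN (h₁.mono hs₁.2.2 hs₂.2.1) (h₂.mono hs₁.1 le_rfl)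
      (h₃.mono hs₂.1 le_rfl)⟩
  exact ⟨by simpa [Eff.join] using hr, hw, by simpa [Eff.join] using ht⟩

theorem TypedLE.cond {M Nt Nf : Exp Lev Flo Ref Dom TyVar} {b₁ st sf b : Eff Lev}
    {τ : Ty Lev Flo TyVar} (hM : TypedLE Sg Γ j F M b₁ .bool) (hNt : Typed Sg j F Γ Nt st τ)
    (hNf : Typed Sg j F Γ Nf sf τ) (h₁ : FlowLE F b₁.r st.w) (h₂ : FlowLE F b₁.r sf.w)
    (hr : (b₁.r ⊔ st.r) ⊔ sf.r ≤ b.r) (hw : b.w ≤ (b₁.w ⊓ st.w) ⊓ sf.w)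
    (ht : ((b₁.t ⊔ st.t) ⊔ sf.t) ⊔ b₁.r ≤ b.t) : TypedLE Sg Γ j F (.cond M Nt Nf) b τ := by
  obtain ⟨s₁, hs₁, hM⟩ := hM
  refine ⟨_, .trans (.join (.join (.join hs₁ (.refl st)) (.refl sf)) (.term hs₁.1)) ?_,
    .cond _ _ _ _ _ _ _ _ _ _ hM hNt hNf (h₁.mono hs₁.1 le_rfl) (h₂.mono hs₁.1 le_rfl)⟩
  exact ⟨by simpa [Eff.join] using hr, by simpa [Eff.join] using hw, ht⟩

theorem ValPair.typedLE₁ {V₁ V₂ : Exp Lev Flo Ref Dom TyVar} {r : Lev} {τ : Ty Lev Flo TyVar}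
    (h : ValPair Sg Γ ℓ F V₁ V₂ r τ) (b : Eff Lev) : TypedLE Sg Γ j F V₁ b τ :=
  (h.typed₁ j F b).typedLE

theorem ValPair.typedLE₂ {V₁ V₂ : Exp Lev Flo Ref Dom TyVar} {r : Lev} {τ : Ty Lev Flo TyVar}
    (h : ValPair Sg Γ ℓ F V₁ V₂ r τ) (b : Eff Lev) : TypedLE Sg Γ j F V₂ b τ :=
  (h.typed₂ j F b).typedLE

/-! ### Inversion of lockstep pairs. -/

theorem Lockstep.of_typedLE {M : Exp Lev Flo Ref Dom TyVar} {b : Eff Lev} {τ : Ty Lev Flo TyVar}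
    {r t : Lev} (h : TypedLE Sg Γ j F M b τ) (hr : b.r ≤ r) (ht : b.t ≤ t) :
    Lockstep Sg Γ ℓ j F M M r t τ :=
  let ⟨_, hs, hM⟩ := h
  .refl hM (hs.1.trans hr) (hs.2.2.trans ht)

/-- Related expressions of which the first one is a value. -/
theorem Lockstep.of_isVal {V₁ M₂ : Exp Lev Flo Ref Dom TyVar} {r t : Lev} {τ : Ty Lev Flo TyVar}
    (h : Lockstep Sg Γ ℓ j F V₁ M₂ r t τ) (hV : V₁.IsVal) :
    HighPair Sg Γ ℓ j F V₁ M₂ r t τ ∨ ValPair Sg Γ ℓ F V₁ M₂ r τ := by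
  cases h with
  | refl hM hr ht => exact .inr (.refl hV hM _)
  | high h => exact .inl h
  | val h => exact .inr h
  | _ => exact hV.elim

/-- Inversion of an application whose function part is not a value. -/
theorem Lockstep.appL_inv {A B M₂ : Exp Lev Flo Ref Dom TyVar} {r t : Lev} {σ : Ty Lev Flo TyVar}
    (h : Lockstep Sg Γ ℓ j F (.app A B) M₂ r t σ) (hA : ¬ A.IsVal) :
    HighPair Sg Γ ℓ j F (.app A B) M₂ r t σ ∨ ∃ A₂ r₀ t₀ τ, M₂ = .app A₂ B ∧
      Lockstep Sg Γ ℓ j F A A₂ r₀ t₀ τ ∧ ∀ X Y, Lockstep Sg Γ ℓ j F X Y r₀ t₀ τ →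
        Lockstep Sg Γ ℓ j F (.app X B) (.app Y B) r t σ := by
  cases h with
  | refl hM hr ht =>
    cases hM with
    | app _ _ _ s s' s'' _ _ _ _ hM hN h₁ h₂ h₃ =>
      exact .inr ⟨A, _, _, _, rfl, .refl hM le_rfl le_rfl,
        fun X Y h => .appL h hN h₁ h₂ h₃ (le_sup_left.trans hr) ht⟩
  | high h => exact .inl h
  | val h => exact h.val₁.elim
  | appL hM hN h₁ h₂ h₃ hr ht =>
    exact .inr ⟨_, _, _, _, rfl, hM, fun X Y h => .appL h hN h₁ h₂ h₃ hr ht⟩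
  | appR hV => exact (hA hV.val₁).elim

/-- Inversion of an application whose function part is a value. -/
theorem Lockstep.appR_inv {A B M₂ : Exp Lev Flo Ref Dom TyVar} {r t : Lev} {σ : Ty Lev Flo TyVar}
    (h : Lockstep Sg Γ ℓ j F (.app A B) M₂ r t σ) (hA : A.IsVal) :
    HighPair Sg Γ ℓ j F (.app A B) M₂ r t σ ∨ ∃ A₂ B₂ r₀ r₁ t₁ s' τ, M₂ = .app A₂ B₂ ∧
      ValPair Sg Γ ℓ F A A₂ r₀ (.fn τ j F s' σ) ∧ Lockstep Sg Γ ℓ j F B B₂ r₁ t₁ τ ∧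
      FlowLE F r₀ s'.w ∧ FlowLE F r₁ s'.w ∧ (r₀ ⊔ s'.r) ⊔ r₁ ≤ r ∧
      (s'.t ⊔ t₁) ⊔ (r₀ ⊔ r₁) ≤ t := by
  have aux : ∀ {a b c d : Lev}, ((a ⊔ b) ⊔ c) ⊔ d ≤ t → (b ⊔ c) ⊔ d ≤ t := fun h =>
    (sup_le_sup_right (sup_le_sup_right le_sup_right _) _).trans h
  cases h with
  | refl hM hr ht =>
    cases hM with
    | app _ _ _ s s' s'' _ _ _ _ hM hN h₁ h₂ h₃ =>
      exact .inr ⟨A, B, _, _, _, _, _, rfl, .refl hA hM _, .refl hN le_rfl le_rfl, h₂, h₃,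
        le_sup_left.trans hr, aux ht⟩
  | high h => exact .inl h
  | val h => exact h.val₁.elim
  | @appL _ _ _ _ r₀ t₀ s' s'' _ _ _ _ hM hN h₁ h₂ h₃ hr ht =>
    rcases hM.of_isVal hA with ⟨k, hk, hkr, hkt, hA₁, hA₂⟩ | hV
    · have hs'' := h₁.le_of_le_cl hkt
      have hs' := h₂.le_of_le_cl hkr
      have hw : k ≤ (k ⊓ s'.w) ⊓ s''.w := le_inf (le_inf le_rfl hs') hs''
      exact .inl ⟨k, hk, le_cl_mono hkr ((le_sup_left.trans le_sup_left).trans hr),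
        le_cl_mono hkr ((le_sup_left.trans le_sup_right).trans ht),
        .app hA₁ hN.typedLE h₁ h₂ h₃ hr hw ht, .app hA₂ hN.typedLE h₁ h₂ h₃ hr hw ht⟩
    · exact .inr ⟨_, _, _, _, _, _, _, rfl, hV, .refl hN le_rfl le_rfl, h₂, h₃, hr, aux ht⟩
  | appR hV hN h₂ h₃ hr ht => exact .inr ⟨_, _, _, _, _, _, _, rfl, hV, hN, h₂, h₃, hr, ht⟩

/-- Inversion of an application of a value to a value. -/
theorem Lockstep.app_inv {A B M₂ : Exp Lev Flo Ref Dom TyVar} {r t : Lev} {σ : Ty Lev Flo TyVar}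
    (h : Lockstep Sg Γ ℓ j F (.app A B) M₂ r t σ) (hA : A.IsVal) (hB : B.IsVal) :
    HighPair Sg Γ ℓ j F (.app A B) M₂ r t σ ∨
      M₂ = .app A B ∧ ∃ w, TypedLE Sg Γ j F (.app A B) ⟨r, w, t⟩ σ := by
  rcases h.appR_inv hA with h | ⟨A₂, B₂, r₀, r₁, t₁, s', τ, rfl, hV, hN, h₂, h₃, hr, ht⟩
  · exact .inl h
  -- A hidden level below the latent writing effect makes the application high. Both `r` and `t`
  -- dominate `r₀ ⊔ r₁`, the latter thanks to the summand that the rule adds to the termination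
  -- effect.
  have high : ∀ {k b}, ¬ k ≤ ℓ → k ≤ s'.w → k ≤ FlowSetting.cl F (r₀ ⊔ r₁) →
      (∀ B', (B' = B ∨ B' = B₂) → TypedLE Sg Γ j F B' b τ) → b.r ≤ r₁ → k ≤ b.w → b.t ≤ t₁ →
      HighPair Sg Γ ℓ j F (.app A B) (.app A₂ B₂) r t σ := by
    intro k b hk hks hkr hb hbr hbw hbt
    have hr' : ((⊥ : Lev) ⊔ s'.r) ⊔ b.r ≤ r :=
      (sup_le_sup (sup_le_sup_right bot_le _) hbr).trans hr
    have ht' : (((⊥ : Lev) ⊔ s'.t) ⊔ b.t) ⊔ (⊥ ⊔ b.r) ≤ t := by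
      rw [bot_sup_eq]
      exact (sup_le_sup (sup_le_sup_left hbt _) (sup_le_sup bot_le hbr)).trans ht
    have hw : k ≤ (⊤ ⊓ s'.w) ⊓ b.w := le_inf (le_inf le_top hks) hbw
    refine ⟨k, hk, le_cl_mono hkr (sup_le ?_ ?_), le_cl_mono hkr (le_sup_right.trans ht), ?_, ?_⟩
    · exact (le_sup_left.trans le_sup_left).trans hr
    · exact le_sup_right.trans hr
    -- The function part is a value, so it may carry the least effect, which trivializes the side
    -- conditions that concern it.
    · exact .app (b₁ := Eff.none) (hV.typedLE₁ _) (hb B (.inl rfl)) (flowLE_bot _) (flowLE_bot _)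
        (h₃.mono hbr le_rfl) hr' hw ht'
    · exact .app (b₁ := Eff.none) (hV.typedLE₂ _) (hb B₂ (.inr rfl)) (flowLE_bot _)
        (flowLE_bot _) (h₃.mono hbr le_rfl) hr' hw ht'
  rcases hN.of_isVal hB with ⟨k, hk, hkr, hkt, hB₁, hB₂⟩ | hV'
  · refine .inl (high (b := ⟨r₁, k, t₁⟩) hk (h₃.le_of_le_cl hkr) (le_cl_mono hkr le_sup_right) ?_ le_rfl le_rfl
      le_rfl)
    rintro B' (rfl | rfl)
    · exact hB₁
    · exact hB₂
  have hb : ∀ B', (B' = B ∨ B' = B₂) → TypedLE Sg Γ j F B' Eff.none τ := by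
    rintro B' (rfl | rfl)
    · exact hV'.typedLE₁ _
    · exact hV'.typedLE₂ _
  -- If the functions or the arguments differ, the hidden level is the closure of the reading effect
  -- of the differing component: `cl F r₀` or `cl F r₁`.
  rcases hV.eq_or with rfl | hd
  · rcases hV'.eq_or with rfl | hd
    · refine .inr ⟨rfl, s'.w, .app (b₁ := Eff.none) (hV.typedLE₁ _) (hV'.typedLE₁ Eff.none)
        (flowLE_bot _) (flowLE_bot _) (flowLE_bot _) ?_ (by simp [Eff.none]) ?_⟩
      · simpa [Eff.none] using (le_sup_right.trans le_sup_left).trans hr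
      · simpa [Eff.none] using (le_sup_left.trans le_sup_left).trans ht
    · exact .inl (high hd (h₃.le_of_le_cl le_rfl) (le_cl_mono le_rfl le_sup_right) hb bot_le
        le_top bot_le)
  · exact .inl (high hd (h₂.le_of_le_cl le_rfl) (le_cl_mono le_rfl le_sup_left) hb bot_le
      le_top bot_le)

theorem Lockstep.seq_inv {A B M₂ : Exp Lev Flo Ref Dom TyVar} {r t : Lev} {σ : Ty Lev Flo TyVar}
    (h : Lockstep Sg Γ ℓ j F (.seq A B) M₂ r t σ) :
    HighPair Sg Γ ℓ j F (.seq A B) M₂ r t σ ∨ ∃ A₂ r₀ t₀ τ, M₂ = .seq A₂ B ∧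
      Lockstep Sg Γ ℓ j F A A₂ r₀ t₀ τ ∧ ∃ s', Typed Sg j F Γ B s' σ ∧ FlowLE F t₀ s'.w ∧
        r₀ ⊔ s'.r ≤ r ∧ t₀ ⊔ s'.t ≤ t := by
  cases h with
  | refl hM hr ht =>
    cases hM with
    | seq _ _ _ _ _ _ _ _ _ hM hN h₁ =>
      exact .inr ⟨A, _, _, _, rfl, .refl hM le_rfl le_rfl, _, hN, h₁, hr, ht⟩
  | high h => exact .inl h
  | val h => exact h.val₁.elim
  | seq hM hN h₁ hr ht => exact .inr ⟨_, _, _, _, rfl, hM, _, hN, h₁, hr, ht⟩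

/-- Inversion of a sequential composition whose first component is a value. -/
theorem Lockstep.seq_val_inv {A B M₂ : Exp Lev Flo Ref Dom TyVar} {r t : Lev}
    {σ : Ty Lev Flo TyVar} (h : Lockstep Sg Γ ℓ j F (.seq A B) M₂ r t σ) (hA : A.IsVal) :
    HighPair Sg Γ ℓ j F (.seq A B) M₂ r t σ ∨ ∃ A₂, M₂ = .seq A₂ B ∧ A₂.IsVal ∧
      ∃ w, TypedLE Sg Γ j F B ⟨r, w, t⟩ σ := by
  rcases h.seq_inv with h | ⟨A₂, r₀, t₀, τ, rfl, hM, s', hN, h₁, hr, ht⟩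
  · exact .inl h
  rcases hM.of_isVal hA with ⟨k, hk, hkr, hkt, hA₁, hA₂⟩ | hV
  · have hw : k ≤ k ⊓ s'.w := le_inf le_rfl (h₁.le_of_le_cl hkt)
    exact .inl ⟨k, hk, le_cl_mono hkr (le_sup_left.trans hr), le_cl_mono hkt (le_sup_left.trans ht),
      .seq hA₁ hN.typedLE h₁ hr hw ht, .seq hA₂ hN.typedLE h₁ hr hw ht⟩
  · exact .inr ⟨A₂, rfl, hV.val₂, s'.w, hN.typedLE.mono
      ⟨le_sup_right.trans hr, le_rfl, le_sup_right.trans ht⟩⟩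

theorem Lockstep.newref_inv {A M₂ : Exp Lev Flo Ref Dom TyVar} {l r t : Lev}
    {θ σ : Ty Lev Flo TyVar} (h : Lockstep Sg Γ ℓ j F (.newref l θ A) M₂ r t σ) :
    HighPair Sg Γ ℓ j F (.newref l θ A) M₂ r t σ ∨ ∃ A₂ r₀ t₀, M₂ = .newref l θ A₂ ∧
      σ = .ref θ l ∧ Lockstep Sg Γ ℓ j F A A₂ r₀ t₀ θ ∧ FlowLE F r₀ l ∧ FlowLE F t₀ l ∧
        r₀ ≤ r ∧ t₀ ≤ t := by
  cases h with
  | refl hM hr ht =>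
    cases hM with
    | newref _ _ _ _ _ _ _ hM h₁ h₂ =>
      exact .inr ⟨A, _, _, rfl, rfl, .refl hM le_rfl le_rfl, h₁, h₂, le_sup_left.trans hr,
        le_sup_left.trans ht⟩
  | high h => exact .inl h
  | val h => exact h.val₁.elim
  | newref hM h₁ h₂ hr ht => exact .inr ⟨_, _, _, rfl, rfl, hM, h₁, h₂, hr, ht⟩

/-- Inversion of the creation of a reference to a value. -/
theorem Lockstep.newref_val_inv {A M₂ : Exp Lev Flo Ref Dom TyVar} {l r t : Lev}
    {θ σ : Ty Lev Flo TyVar} (h : Lockstep Sg Γ ℓ j F (.newref l θ A) M₂ r t σ) (hA : A.IsVal) :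
    HighPair Sg Γ ℓ j F (.newref l θ A) M₂ r t σ ∨ ∃ A₂ r₀, M₂ = .newref l θ A₂ ∧
      σ = .ref θ l ∧ ValPair Sg Γ ℓ F A A₂ r₀ θ ∧ (A = A₂ ∨ ¬ l ≤ ℓ) := by
  rcases h.newref_inv with h | ⟨A₂, r₀, t₀, rfl, rfl, hM, h₁, h₂, hr, ht⟩
  · exact .inl h
  rcases hM.of_isVal hA with ⟨k, hk, hkr, hkt, hA₁, hA₂⟩ | hV
  · have hw : k ≤ k ⊓ l := le_inf le_rfl (h₂.le_of_le_cl hkt)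
    exact .inl ⟨k, hk, le_cl_mono hkr hr, le_cl_mono hkt ht,
      .newref hA₁ h₁ h₂ hr hw ht, .newref hA₂ h₁ h₂ hr hw ht⟩
  -- Distinct values have `cl F r₀` hidden, and `cl F r₀ ≤ l`, so they are stored at a hidden level.
  · exact .inr ⟨A₂, r₀, rfl, rfl, hV,
      hV.eq_or.imp_right fun hd hl => hd ((h₁.le_of_le_cl le_rfl).trans hl)⟩

theorem Lockstep.deref_inv {A M₂ : Exp Lev Flo Ref Dom TyVar} {r t : Lev}
    {θ : Ty Lev Flo TyVar} (h : Lockstep Sg Γ ℓ j F (.deref A) M₂ r t θ) :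
    HighPair Sg Γ ℓ j F (.deref A) M₂ r t θ ∨ ∃ A₂ l r₀ t₀, M₂ = .deref A₂ ∧
      Lockstep Sg Γ ℓ j F A A₂ r₀ t₀ (.ref θ l) ∧ r₀ ⊔ l ≤ r ∧ t₀ ≤ t := by
  cases h with
  | refl hM hr ht =>
    cases hM with
    | deref _ _ _ _ _ _ _ hM =>
      exact .inr ⟨A, _, _, _, rfl, .refl hM le_rfl le_rfl, hr, le_sup_left.trans ht⟩
  | high h => exact .inl h
  | val h => exact h.val₁.elim
  | deref hM hr ht => exact .inr ⟨_, _, _, _, rfl, hM, hr, ht⟩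

/-- Inversion of the dereferencing of a value. -/
theorem Lockstep.deref_val_inv {A M₂ : Exp Lev Flo Ref Dom TyVar} {r t : Lev}
    {θ : Ty Lev Flo TyVar} (h : Lockstep Sg Γ ℓ j F (.deref A) M₂ r t θ) (hA : A.IsVal) :
    HighPair Sg Γ ℓ j F (.deref A) M₂ r t θ ∨ ∃ A₂ l, M₂ = .deref A₂ ∧
      ValPair Sg Γ ℓ F A A₂ r (.ref θ l) ∧ l ≤ r := by
  rcases h.deref_inv with h | ⟨A₂, l, r₀, t₀, rfl, hM, hr, ht⟩
  · exact .inl h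
  rcases hM.of_isVal hA with ⟨k, hk, hkr, hkt, hA₁, hA₂⟩ | hV
  · exact .inl ⟨k, hk, le_cl_mono hkr (le_sup_left.trans hr), le_cl_mono hkt ht,
      .deref hA₁ hr le_rfl ht, .deref hA₂ hr le_rfl ht⟩
  · exact .inr ⟨A₂, l, rfl, ⟨hV.val₁, hV.val₂, hV.typed₁, hV.typed₂,
      hV.eq_or.imp_right fun hd hl => hd ((FlowSetting.cl_mono _ _ _
        (le_sup_left.trans hr)).trans hl)⟩, le_sup_right.trans hr⟩

/-- Inversion of an assignment whose left part is not a value. -/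
theorem Lockstep.assignL_inv {A B M₂ : Exp Lev Flo Ref Dom TyVar} {r t : Lev}
    {σ : Ty Lev Flo TyVar} (h : Lockstep Sg Γ ℓ j F (.assign A B) M₂ r t σ) (hA : ¬ A.IsVal) :
    HighPair Sg Γ ℓ j F (.assign A B) M₂ r t σ ∨ ∃ A₂ r₀ t₀ τ, M₂ = .assign A₂ B ∧
      Lockstep Sg Γ ℓ j F A A₂ r₀ t₀ τ ∧ ∀ X Y, Lockstep Sg Γ ℓ j F X Y r₀ t₀ τ →
        Lockstep Sg Γ ℓ j F (.assign X B) (.assign Y B) r t σ := by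
  cases h with
  | refl hM hr ht =>
    cases hM with
    | assign _ _ _ s s' _ _ _ _ hM hN h₁ h₂ h₃ =>
      exact .inr ⟨A, _, _, _, rfl, .refl hM le_rfl le_rfl,
        fun X Y h => .assignL h hN h₁ h₂ h₃ (le_sup_left.trans hr) (le_sup_left.trans ht)⟩
  | high h => exact .inl h
  | val h => exact h.val₁.elim
  | assignL hM hN h₁ h₂ h₃ hr ht =>
    exact .inr ⟨_, _, _, _, rfl, hM, fun X Y h => .assignL h hN h₁ h₂ h₃ hr ht⟩
  | assignR hV => exact (hA hV.val₁).elim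

/-- Inversion of an assignment whose left part is a value. -/
theorem Lockstep.assignR_inv {A B M₂ : Exp Lev Flo Ref Dom TyVar} {r t : Lev}
    {σ : Ty Lev Flo TyVar} (h : Lockstep Sg Γ ℓ j F (.assign A B) M₂ r t σ) (hA : A.IsVal) :
    HighPair Sg Γ ℓ j F (.assign A B) M₂ r t σ ∨ ∃ A₂ B₂ l r₀ r₁ t₁ θ, M₂ = .assign A₂ B₂ ∧
      σ = .unit ∧ ValPair Sg Γ ℓ F A A₂ r₀ (.ref θ l) ∧ Lockstep Sg Γ ℓ j F B B₂ r₁ t₁ θ ∧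
      FlowLE F r₀ l ∧ FlowLE F r₁ l ∧ r₀ ⊔ r₁ ≤ r ∧ t₁ ≤ t := by
  cases h with
  | refl hM hr ht =>
    cases hM with
    | assign _ _ _ s s' _ _ _ _ hM hN h₁ h₂ h₃ =>
      exact .inr ⟨A, B, _, _, _, _, _, rfl, rfl, .refl hA hM _, .refl hN le_rfl le_rfl, h₂, h₃,
        le_sup_left.trans hr, (le_sup_right.trans le_sup_left).trans ht⟩
  | high h => exact .inl h
  | val h => exact h.val₁.elim
  | @assignL _ _ _ _ r₀ t₀ s' l _ _ _ hM hN h₁ h₂ h₃ hr ht =>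
    rcases hM.of_isVal hA with ⟨k, hk, hkr, hkt, hA₁, hA₂⟩ | hV
    · have hw : k ≤ (k ⊓ s'.w) ⊓ l :=
        le_inf (le_inf le_rfl (h₁.le_of_le_cl hkt)) (h₂.le_of_le_cl hkr)
      exact .inl ⟨k, hk, le_cl_mono hkr (le_sup_left.trans hr),
        le_cl_mono hkt (le_sup_left.trans ht),
        .assign hA₁ hN.typedLE h₁ h₂ h₃ hr hw ht, .assign hA₂ hN.typedLE h₁ h₂ h₃ hr hw ht⟩
    · exact .inr ⟨_, _, _, _, _, _, _, rfl, rfl, hV, .refl hN le_rfl le_rfl, h₂, h₃, hr,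
        le_sup_right.trans ht⟩
  | assignR hV hN h₂ h₃ hr ht => exact .inr ⟨_, _, _, _, _, _, _, rfl, rfl, hV, hN, h₂, h₃, hr, ht⟩

/-- Inversion of an assignment of a value to a value. -/
theorem Lockstep.assign_inv {A B M₂ : Exp Lev Flo Ref Dom TyVar} {r t : Lev}
    {σ : Ty Lev Flo TyVar} (h : Lockstep Sg Γ ℓ j F (.assign A B) M₂ r t σ) (hA : A.IsVal)
    (hB : B.IsVal) :
    HighPair Sg Γ ℓ j F (.assign A B) M₂ r t σ ∨ ∃ A₂ B₂ l r₀ r₁ θ, M₂ = .assign A₂ B₂ ∧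
      σ = .unit ∧ ValPair Sg Γ ℓ F A A₂ r₀ (.ref θ l) ∧ ValPair Sg Γ ℓ F B B₂ r₁ θ ∧
      (A = A₂ ∧ B = B₂ ∨ ¬ l ≤ ℓ) := by
  rcases h.assignR_inv hA with h | ⟨A₂, B₂, l, r₀, r₁, t₁, θ, rfl, rfl, hV, hN, h₂, h₃, hr, ht⟩
  · exact .inl h
  rcases hN.of_isVal hB with ⟨k, hk, hkr, hkt, hB₁, hB₂⟩ | hV'
  · have hw : k ≤ (⊤ ⊓ k) ⊓ l := le_inf (le_inf le_top le_rfl) (h₃.le_of_le_cl hkr)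
    have hr' : ⊥ ⊔ r₁ ≤ r := (sup_le_sup_right bot_le _).trans hr
    have ht' : ⊥ ⊔ t₁ ≤ t := by rwa [bot_sup_eq]
    exact .inl ⟨k, hk, le_cl_mono hkr (le_sup_right.trans hr), le_cl_mono hkt ht,
      .assign (b₁ := Eff.none) (hV.typedLE₁ _) hB₁ (flowLE_bot _) (flowLE_bot _) h₃ hr' hw ht',
      .assign (b₁ := Eff.none) (hV.typedLE₂ _) hB₂ (flowLE_bot _) (flowLE_bot _) h₃ hr' hw ht'⟩
  · refine .inr ⟨A₂, B₂, l, r₀, r₁, θ, rfl, rfl, hV, hV', ?_⟩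
    -- Whichever side differs, the closure of its reading effect is hidden and lies below the level
    -- `l` that is written.
    rcases hV.eq_or with rfl | hd
    · exact hV'.eq_or.imp (⟨rfl, ·⟩) fun hd hl => hd ((h₃.le_of_le_cl le_rfl).trans hl)
    · exact .inr fun hl => hd ((h₂.le_of_le_cl le_rfl).trans hl)

theorem Lockstep.cond_inv {A Nt Nf M₂ : Exp Lev Flo Ref Dom TyVar} {r t : Lev}
    {τ : Ty Lev Flo TyVar} (h : Lockstep Sg Γ ℓ j F (.cond A Nt Nf) M₂ r t τ) :
    HighPair Sg Γ ℓ j F (.cond A Nt Nf) M₂ r t τ ∨ ∃ A₂ r₀ t₀ st sf, M₂ = .cond A₂ Nt Nf ∧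
      Lockstep Sg Γ ℓ j F A A₂ r₀ t₀ .bool ∧ Typed Sg j F Γ Nt st τ ∧ Typed Sg j F Γ Nf sf τ ∧
      FlowLE F r₀ st.w ∧ FlowLE F r₀ sf.w ∧ (r₀ ⊔ st.r) ⊔ sf.r ≤ r ∧
      ((t₀ ⊔ st.t) ⊔ sf.t) ⊔ r₀ ≤ t := by
  cases h with
  | refl hM hr ht =>
    cases hM with
    | cond _ _ _ _ st sf _ _ _ _ hM hNt hNf h₁ h₂ =>
      exact .inr ⟨A, _, _, _, _, rfl, .refl hM le_rfl le_rfl, hNt, hNf, h₁, h₂,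
        le_sup_left.trans hr, ht⟩
  | high h => exact .inl h
  | val h => exact h.val₁.elim
  | cond hM hNt hNf h₁ h₂ hr ht =>
    exact .inr ⟨_, _, _, _, _, rfl, hM, hNt, hNf, h₁, h₂, hr, ht⟩

/-- Inversion of a conditional whose guard is a value. -/
theorem Lockstep.cond_val_inv {A Nt Nf M₂ : Exp Lev Flo Ref Dom TyVar} {r t : Lev}
    {τ : Ty Lev Flo TyVar} (h : Lockstep Sg Γ ℓ j F (.cond A Nt Nf) M₂ r t τ) (hA : A.IsVal) :
    HighPair Sg Γ ℓ j F (.cond A Nt Nf) M₂ r t τ ∨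
      M₂ = .cond A Nt Nf ∧ ∃ w, TypedLE Sg Γ j F (.cond A Nt Nf) ⟨r, w, t⟩ τ := by
  rcases h.cond_inv with h | ⟨A₂, r₀, t₀, st, sf, rfl, hM, hNt, hNf, h₁, h₂, hr, ht⟩
  · exact .inl h
  rcases hM.of_isVal hA with ⟨k, hk, hkr, hkt, hA₁, hA₂⟩ | hV
  · have hw : k ≤ (k ⊓ st.w) ⊓ sf.w :=
      le_inf (le_inf le_rfl (h₁.le_of_le_cl hkr)) (h₂.le_of_le_cl hkr)
    exact .inl ⟨k, hk, le_cl_mono hkr ((le_sup_left.trans le_sup_left).trans hr),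
      le_cl_mono hkr (le_sup_right.trans ht),
      .cond hA₁ hNt hNf h₁ h₂ hr hw ht, .cond hA₂ hNt hNf h₁ h₂ hr hw ht⟩
  have hr' : ((⊥ : Lev) ⊔ st.r) ⊔ sf.r ≤ r :=
    (sup_le_sup_right (sup_le_sup_right bot_le _) _).trans hr
  have ht' : (((⊥ : Lev) ⊔ st.t) ⊔ sf.t) ⊔ ⊥ ≤ t :=
    (sup_le_sup (sup_le_sup_right (sup_le_sup_right bot_le _) _) bot_le).trans ht
  rcases hV.eq_or with rfl | hd
  · exact .inr ⟨rfl, _, .cond (b₁ := Eff.none) (hV.typedLE₁ _) hNt hNf (flowLE_bot _)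
      (flowLE_bot _) hr' le_rfl ht'⟩
  -- Distinct guards: the hidden level is `cl F r₀`, which lies below the writes of both branches
  -- and is accounted for in `t` by the summand `r₀`.
  · have hw : FlowSetting.cl F r₀ ≤ (⊤ ⊓ st.w) ⊓ sf.w :=
      le_inf (le_inf le_top (h₁.le_of_le_cl le_rfl)) (h₂.le_of_le_cl le_rfl)
    exact .inl ⟨_, hd, le_cl_mono le_rfl ((le_sup_left.trans le_sup_left).trans hr),
      le_cl_mono le_rfl (le_sup_right.trans ht),
      .cond (b₁ := Eff.none) (hV.typedLE₁ _) hNt hNf (flowLE_bot _) (flowLE_bot _) hr' hw ht',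
      .cond (b₁ := Eff.none) (hV.typedLE₂ _) hNt hNf (flowLE_bot _) (flowLE_bot _) hr' hw ht'⟩

/-- The same `k` works outside the declaration, because `F ⊓ G` collapses levels at least as much as
`F` does. -/
theorem HighPair.flow {G : Flo} {M₁ M₂ : Exp Lev Flo Ref Dom TyVar} {r t : Lev}
    {τ : Ty Lev Flo TyVar} (h : HighPair Sg Γ ℓ j (F ⊓ G) M₁ M₂ r t τ) :
    HighPair Sg Γ ℓ j F (.flow G M₁) (.flow G M₂) r t τ :=
  have hF := FlowSetting.cl_perm (Lev := Lev) _ _ (inf_le_left (a := F) (b := G))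
  let ⟨k, hk, hr, ht, ⟨s₁, hs₁, h₁⟩, ⟨s₂, hs₂, h₂⟩⟩ := h
  ⟨k, hk, hr.trans (hF _), ht.trans (hF _), ⟨s₁, hs₁, .flow _ _ _ _ _ _ _ h₁⟩,
    ⟨s₂, hs₂, .flow _ _ _ _ _ _ _ h₂⟩⟩

theorem Lockstep.flow_inv {G : Flo} {A M₂ : Exp Lev Flo Ref Dom TyVar} {r t : Lev}
    {τ : Ty Lev Flo TyVar} (h : Lockstep Sg Γ ℓ j F (.flow G A) M₂ r t τ) :
    HighPair Sg Γ ℓ j F (.flow G A) M₂ r t τ ∨ ∃ A₂, M₂ = .flow G A₂ ∧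
      Lockstep Sg Γ ℓ j (F ⊓ G) A A₂ r t τ := by
  cases h with
  | refl hM hr ht =>
    cases hM with
    | flow _ _ _ _ _ _ _ hM => exact .inr ⟨A, rfl, .refl hM hr ht⟩
  | high h => exact .inl h
  | val h => exact h.val₁.elim
  | flow hM => exact .inr ⟨_, rfl, hM⟩

end Lockstep

section Bisimulation

variable [Lattice Lev] [BoundedOrder Lev] [Lattice Flo] [BoundedOrder Flo] [FlowSetting Lev Flo]

/-! ### Low-equality -/

section LowEq

variable {Sg : Ref → Lev × Ty Lev Flo TyVar} {Up : Nam → Lev} {ℓ : Lev}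
  {S₁ S₂ : Store Lev Flo Ref Dom TyVar} {T₁ T₂ : Tracker Nam Dom}

/-- Whatever is visible under `⊤` is visible under `F`. This is why declassifying low-equality
before a step suffices for strict low-equality after it. -/
theorem LowEqState.top {F : Flo} (h : LowEqState Sg Up F ℓ T₁ S₁ T₂ S₂) :
    LowEqState Sg Up (⊤ : Flo) ℓ T₁ S₁ T₂ S₂ :=
  ⟨fun a ha => h.1 a (ha.anti le_top), fun n hn => h.2 n (hn.anti le_top)⟩

theorem LowEqState.trans {F : Flo} {S₃ : Store Lev Flo Ref Dom TyVar} {T₃ : Tracker Nam Dom}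
    (h : LowEqState Sg Up F ℓ T₁ S₁ T₂ S₂) (h' : LowEqState Sg Up F ℓ T₂ S₂ T₃ S₃) :
    LowEqState Sg Up F ℓ T₁ S₁ T₃ S₃ :=
  ⟨fun a ha => (h.1 a ha).trans (h'.1 a ha), fun n hn => (h.2 n hn).trans (h'.2 n hn)⟩

theorem LowEqStore.update [DecidableEq Ref] (h : LowEqStore Sg (⊤ : Flo) ℓ S₁ S₂) {a : Ref}
    {V₁ V₂ : Val Lev Flo Ref Dom TyVar} (hV : V₁ = V₂ ∨ ¬ (Sg a).1 ≤ ℓ) :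
    LowEqStore Sg (⊤ : Flo) ℓ (Function.update S₁ a (some V₁))
      (Function.update S₂ a (some V₂)) := by
  intro b hb
  by_cases hba : b = a
  · subst hba
    rw [Function.update_self, Function.update_self, hV.resolve_right (not_not.2 (flowLE_top.1 hb))]
  · rw [Function.update_of_ne hba, Function.update_of_ne hba]
    exact h b hb

theorem LowEqStore.update_left [DecidableEq Ref] (h : LowEqStore Sg (⊤ : Flo) ℓ S₁ S₂) {a : Ref}
    {V : Val Lev Flo Ref Dom TyVar} (ha : ¬ (Sg a).1 ≤ ℓ) :
    LowEqStore Sg (⊤ : Flo) ℓ (Function.update S₁ a (some V)) S₂ := by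
  intro b hb
  rw [Function.update_of_ne]
  · exact h b hb
  · rintro rfl
    exact ha (flowLE_top.1 hb)

theorem LowEqStore.update_right [DecidableEq Ref] (h : LowEqStore Sg (⊤ : Flo) ℓ S₁ S₂) {a : Ref}
    {V : Val Lev Flo Ref Dom TyVar} (ha : ¬ (Sg a).1 ≤ ℓ) :
    LowEqStore Sg (⊤ : Flo) ℓ S₁ (Function.update S₂ a (some V)) := by
  intro b hb
  rw [Function.update_of_ne]
  · exact h b hb
  · rintro rfl
    exact ha (flowLE_top.1 hb)

theorem LowEqTracker.update [DecidableEq Nam] (h : LowEqTracker Up (⊤ : Flo) ℓ T₁ T₂) (n : Nam)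
    (d : Dom) : LowEqTracker Up (⊤ : Flo) ℓ (Function.update T₁ n (some d))
      (Function.update T₂ n (some d)) := by
  intro b hb
  by_cases hba : b = n
  · subst hba
    rw [Function.update_self, Function.update_self]
  · rw [Function.update_of_ne hba, Function.update_of_ne hba]
    exact h b hb

end LowEq

/-! ### One step of a thread -/

/-- A value of reference type, in an environment without variables of reference type, is a
reference name. -/
theorem Typed.eq_loc {Sg : Ref → Lev × Ty Lev Flo TyVar} {Γ : Ctx Lev Flo TyVar}
    (hΓ : ∀ (k : ℕ) (θ : Ty Lev Flo TyVar) (l : Lev), Γ k ≠ some (.ref θ l))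
    {V : Exp Lev Flo Ref Dom TyVar} (hV : V.IsVal) {j : Lev} {F : Flo} {s : Eff Lev}
    {θ : Ty Lev Flo TyVar} {l : Lev} (h : Typed Sg j F Γ V s (.ref θ l)) :
    ∃ a, V = .loc a ∧ (Sg a).1 = l ∧ (Sg a).2 = θ := by
  cases h with
  | loc _ _ _ _ a => exact ⟨a, rfl, rfl, rfl⟩
  | var _ _ _ _ k _ hk => exact (hΓ _ _ _ hk).elim
  | _ => exact hV.elim

/-- A thread that is typed with a writing effect that is not visible at `ℓ`. -/
def HighThread (Sg : Ref → Lev × Ty Lev Flo TyVar) (Γ : Ctx Lev Flo TyVar) (Up : Nam → Lev)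
    (ℓ : Lev) (m : Nam) (M : Exp Lev Flo Ref Dom TyVar) : Prop :=
  ∃ s τ, Typed Sg (Up m) (⊤ : Flo) Γ M s τ ∧ ¬ s.w ≤ ℓ

section Step

variable [DecidableEq Ref] [DecidableEq Nam]

/-- The thread `m` with expression `M₂` can match, in the state `T₂, S₂`, a step that leads to the
state `T₁', S₁'` and creates the thread `new`, if any: it stands still or makes one step, and its
resulting expression satisfies `Q`. -/
def Matches (W : Dom → Option Flo) (Sg : Ref → Lev × Ty Lev Flo TyVar) (Up : Nam → Lev)
    (Γ : Ctx Lev Flo TyVar) (ℓ : Lev) (m : Nam) (T₁' : Tracker Nam Dom)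
    (S₁' : Store Lev Flo Ref Dom TyVar) (T₂ : Tracker Nam Dom)
    (S₂ : Store Lev Flo Ref Dom TyVar) (new : Option (Nam × Exp Lev Flo Ref Dom TyVar))
    (Q : Exp Lev Flo Ref Dom TyVar → Prop) (M₂ : Exp Lev Flo Ref Dom TyVar) : Prop :=
  (Q M₂ ∧ LowEqState Sg Up (⊤ : Flo) ℓ T₁' S₁' T₂ S₂ ∧
    ∀ n N, new = some (n, N) → HighThread Sg Γ Up ℓ n N) ∨
  ∃ E₂ R₂ R₂' T₂' S₂', M₂ = ECtx.fill R₂ E₂ ∧ Redex W Sg Up T₂ m S₂ R₂ T₂' R₂' new S₂' ∧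
    Q (E₂.fill R₂') ∧ LowEqState Sg Up (⊤ : Flo) ℓ T₁' S₁' T₂' S₂' ∧ Compatible Sg Γ S₂' ∧
    ∀ n N, new = some (n, N) → ∃ s τ, Typed Sg (Up n) (⊤ : Flo) Γ N s τ

variable {W : Dom → Option Flo} {Sg : Ref → Lev × Ty Lev Flo TyVar} {Up : Nam → Lev}
  {Γ : Ctx Lev Flo TyVar} {ℓ : Lev} {m : Nam} {T₁ T₁' T₂ : Tracker Nam Dom}
  {S₁ S₁' S₂ : Store Lev Flo Ref Dom TyVar} {R R' : Exp Lev Flo Ref Dom TyVar}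
  {new : Option (Nam × Exp Lev Flo Ref Dom TyVar)}

/-- Matching extends to evaluation contexts. -/
theorem Matches.frame {Q Q' : Exp Lev Flo Ref Dom TyVar → Prop} {M₂ : Exp Lev Flo Ref Dom TyVar}
    (h : Matches W Sg Up Γ ℓ m T₁' S₁' T₂ S₂ new Q M₂)
    (K : ECtx Lev Flo Ref Dom TyVar → ECtx Lev Flo Ref Dom TyVar)
    (C : Exp Lev Flo Ref Dom TyVar → Exp Lev Flo Ref Dom TyVar)
    (hK : ∀ E M, (K E).fill M = C (E.fill M)) (hQ : ∀ X, Q X → Q' (C X)) :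
    Matches W Sg Up Γ ℓ m T₁' S₁' T₂ S₂ new Q' (C M₂) := by
  rcases h with ⟨h, hs⟩ | ⟨E, R, R', T, S, rfl, hR, h, hs⟩
  · exact .inl ⟨hQ _ h, hs⟩
  · exact .inr ⟨K E, R, R', T, S, (hK _ _).symm, hR, hK E R' ▸ hQ _ h, hs⟩

/-- A step of a thread with a writing effect that is not visible. -/
theorem Typed.high_step {j k : Lev} {F : Flo} {s : Eff Lev} {τ : Ty Lev Flo TyVar}
    {E : ECtx Lev Flo Ref Dom TyVar} (h : Typed Sg j F Γ (E.fill R) s τ) (hk : ¬ k ≤ ℓ)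
    (hw : k ≤ s.w) (hR : Redex W Sg Up T₁ m S₁ R T₁' R' new S₁') (hS : Compatible Sg Γ S₁) :
    (∃ s', s'.Sub s ∧ Typed Sg j F Γ (E.fill R') s' τ) ∧
      LowEqState Sg Up (⊤ : Flo) ℓ T₁' S₁' T₁ S₁ ∧
      ∀ n N, new = some (n, N) → HighThread Sg Γ Up ℓ n N := by
  obtain ⟨F', s', τ', hT, hs'⟩ := h.of_fill
  refine ⟨h.fill_mono fun _ _ _ h => hR.typed hS h,
    hR.lowEqState_of_high hT fun h => hk ((hw.trans hs').trans h), fun n N hn => ?_⟩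
  obtain ⟨s₁, h₁, hs₁⟩ := hR.typed_new hT hn
  exact ⟨s₁, _, h₁, fun h => hk (((hw.trans hs').trans hs₁).trans h)⟩

/-- The second side stands still. The writing effect of `R` is at least `k`, so its changes of the
state are invisible and a thread it creates is high; since effects only shrink, the same `k` serves
for the reduct. -/
theorem HighPair.matches {j : Lev} {F G : Flo} {E : ECtx Lev Flo Ref Dom TyVar}
    {M₂ : Exp Lev Flo Ref Dom TyVar} {r t : Lev} {τ : Ty Lev Flo TyVar}
    (h : HighPair Sg Γ ℓ j F (E.fill R) M₂ r t τ)
    (hR : Redex W Sg Up T₁ m S₁ R T₁' R' new S₁') (hS : Compatible Sg Γ S₁)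
    (hs : LowEqState Sg Up G ℓ T₁ S₁ T₂ S₂) :
    Matches W Sg Up Γ ℓ m T₁' S₁' T₂ S₂ new
      (fun X => Lockstep Sg Γ ℓ j F (E.fill R') X r t τ) M₂ := by
  obtain ⟨k, hk, hr, ht, ⟨s₁, hs₁, h₁⟩, h₂⟩ := h
  obtain ⟨⟨s', hs', h'⟩, hst, hn⟩ := h₁.high_step hk hs₁.2.1 hR hS
  exact .inl ⟨.high ⟨k, hk, hr, ht, ⟨s', hs'.trans hs₁, h'⟩, h₂⟩, hst.trans hs.top, hn⟩

/-- Matching of a redex that neither depends on the state nor changes it. -/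
theorem TypedLE.matches {F G : Flo} {b : Eff Lev} {τ : Ty Lev Flo TyVar}
    (h : TypedLE Sg Γ (Up m) F R b τ) (hR : Redex W Sg Up T₁ m S₁ R T₁ R' none S₁)
    (hR₂ : Redex W Sg Up T₂ m S₂ R T₂ R' none S₂) (hS : Compatible Sg Γ S₁)
    (hS₂ : Compatible Sg Γ S₂) (hs : LowEqState Sg Up G ℓ T₁ S₁ T₂ S₂) :
    Matches W Sg Up Γ ℓ m T₁ S₁ T₂ S₂ none
      (fun X => Lockstep Sg Γ ℓ (Up m) F R' X b.r b.t τ) R := by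
  obtain ⟨s, hsb, h⟩ := h
  obtain ⟨s', hs', h'⟩ := hR.typed hS h
  exact .inr ⟨.hole, R, R', T₂, S₂, rfl, hR₂,
    .refl h' (hs'.1.trans hsb.1) (hs'.2.2.trans hsb.2.2), hs.top, hS₂, nofun⟩

omit [DecidableEq Ref] [DecidableEq Nam] in
theorem Lockstep.fix_inv {j : Lev} {F : Flo} {X M₂ : Exp Lev Flo Ref Dom TyVar} {r t : Lev}
    {τ : Ty Lev Flo TyVar} (h : Lockstep Sg Γ ℓ j F (.fix X) M₂ r t τ) :
    HighPair Sg Γ ℓ j F (.fix X) M₂ r t τ ∨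
      M₂ = .fix X ∧ ∃ w, TypedLE Sg Γ j F (.fix X) ⟨r, w, t⟩ τ := by
  cases h with
  | refl hM hr ht => exact .inr ⟨rfl, _, _, ⟨hr, le_rfl, ht⟩, hM⟩
  | high h => exact .inl h
  | val h => exact h.val₁.elim

omit [DecidableEq Ref] [DecidableEq Nam] in
theorem Lockstep.allowed_inv {j : Lev} {F G : Flo} {Nt Nf M₂ : Exp Lev Flo Ref Dom TyVar}
    {r t : Lev} {τ : Ty Lev Flo TyVar} (h : Lockstep Sg Γ ℓ j F (.allowed G Nt Nf) M₂ r t τ) :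
    HighPair Sg Γ ℓ j F (.allowed G Nt Nf) M₂ r t τ ∨ M₂ = .allowed G Nt Nf ∧
      ∃ st sf, Typed Sg j F Γ Nt st τ ∧ Typed Sg j F Γ Nf sf τ ∧ FlowLE F j st.w ∧
        FlowLE F j sf.w ∧ (st.r ⊔ sf.r) ⊔ j ≤ r ∧ (st.t ⊔ sf.t) ⊔ j ≤ t := by
  cases h with
  | refl hM hr ht =>
    cases hM with
    | allowed _ _ _ _ _ _ _ _ _ hNt hNf h₁ h₂ =>
      exact .inr ⟨rfl, _, _, hNt, hNf, h₁, h₂, hr, ht⟩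
  | high h => exact .inl h
  | val h => exact h.val₁.elim

omit [DecidableEq Ref] in
/-- A policy test in a thread of a level that is not visible is related to its branches. -/
theorem HighPair.allowed {j : Lev} {F G : Flo} {Nt Nf : Exp Lev Flo Ref Dom TyVar}
    {st sf : Eff Lev} {r t : Lev} {τ : Ty Lev Flo TyVar} (ht : Typed Sg j F Γ Nt st τ)
    (hf : Typed Sg j F Γ Nf sf τ) (h₁ : FlowLE F j st.w) (h₂ : FlowLE F j sf.w)
    (hr : (st.r ⊔ sf.r) ⊔ j ≤ r) (htt : (st.t ⊔ sf.t) ⊔ j ≤ t) (hj : ¬ FlowLE F j ℓ) :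
    HighPair Sg Γ ℓ j F Nt (.allowed G Nt Nf) r t τ ∧
      HighPair Sg Γ ℓ j F Nf (.allowed G Nt Nf) r t τ := by
  have hk := not_cl_le_of_not_flowLE hj
  have hkr := le_cl_mono (F := F) le_rfl (le_sup_right.trans hr)
  have hkt := le_cl_mono (F := F) le_rfl (le_sup_right.trans htt)
  have hw₁ := h₁.le_of_le_cl le_rfl
  have hw₂ := h₂.le_of_le_cl le_rfl
  have ha : TypedLE Sg Γ j F (.allowed G Nt Nf) ⟨r, FlowSetting.cl F j, t⟩ τ :=
    ⟨_, ⟨hr, le_inf (le_inf hw₁ hw₂) le_top, htt⟩, .allowed _ _ _ _ _ _ _ _ _ ht hf h₁ h₂⟩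
  exact ⟨⟨_, hk, hkr, hkt, ⟨st, ⟨(le_sup_left.trans le_sup_left).trans hr, hw₁,
    (le_sup_left.trans le_sup_left).trans htt⟩, ht⟩, ha⟩,
    ⟨_, hk, hkr, hkt, ⟨sf, ⟨(le_sup_right.trans le_sup_left).trans hr, hw₂,
    (le_sup_right.trans le_sup_left).trans htt⟩, hf⟩, ha⟩⟩

/-- A reduction of the first of two related redexes is matched by the second one. -/
theorem Lockstep.matches_redex
    (hΓ : ∀ (k : ℕ) (θ : Ty Lev Flo TyVar) (l : Lev), Γ k ≠ some (.ref θ l))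
    (hR : Redex W Sg Up T₁ m S₁ R T₁' R' new S₁') (hS₁ : Compatible Sg Γ S₁)
    (hS₂ : Compatible Sg Γ S₂) (hfS : (pdom S₁' \ pdom S₁) ∩ pdom S₂ = ∅)
    (hfT : (pdom T₁' \ pdom T₁) ∩ pdom T₂ = ∅) {F : Flo} {M₂ : Exp Lev Flo Ref Dom TyVar}
    {r t : Lev} {τ : Ty Lev Flo TyVar} (h : Lockstep Sg Γ ℓ (Up m) F R M₂ r t τ)
    (hM₂ : M₂.rn ⊆ pdom S₂) (hs : LowEqState Sg Up F ℓ T₁ S₁ T₂ S₂) :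
    Matches W Sg Up Γ ℓ m T₁' S₁' T₂ S₂ new
      (fun X => Lockstep Sg Γ ℓ (Up m) F R' X r t τ) M₂ := by
  have high : HighPair Sg Γ ℓ (Up m) F R M₂ r t τ → Matches W Sg Up Γ ℓ m T₁' S₁' T₂ S₂ new
      (fun X => Lockstep Sg Γ ℓ (Up m) F R' X r t τ) M₂ :=
    fun h => h.matches (E := .hole) hR hS₁ hs
  cases hR with
  | beta M V hV =>
    rcases h.app_inv trivial hV with h | ⟨rfl, w, h⟩
    · exact high h
    · exact h.matches (.beta M V hV) (.beta M V hV) hS₁ hS₂ hs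
  | condTrue Nt Nf =>
    rcases h.cond_val_inv trivial with h | ⟨rfl, w, h⟩
    · exact high h
    · exact h.matches (.condTrue _ _) (.condTrue _ _) hS₁ hS₂ hs
  | condFalse Nt Nf =>
    rcases h.cond_val_inv trivial with h | ⟨rfl, w, h⟩
    · exact high h
    · exact h.matches (.condFalse _ _) (.condFalse _ _) hS₁ hS₂ hs
  | fix X hX =>
    rcases h.fix_inv with h | ⟨rfl, w, h⟩
    · exact high h
    · exact h.matches (.fix X hX) (.fix X hX) hS₁ hS₂ hs
  | seq V N hV =>
    rcases h.seq_val_inv hV with h | ⟨A₂, rfl, hA₂, w, h⟩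
    · exact high h
    · exact .inr ⟨.hole, _, _, _, _, rfl, .seq A₂ _ hA₂, .of_typedLE h le_rfl le_rfl, hs.top, hS₂,
        nofun⟩
  | flow G V hV =>
    rcases h.flow_inv with h | ⟨A₂, rfl, h'⟩
    · exact high h
    rcases h'.of_isVal hV with h' | h'
    · exact high h'.flow
    -- A reading effect that is hidden under `F ⊓ G` stays hidden when the declaration is left.
    · exact .inr ⟨.hole, _, _, _, _, rfl, .flow G A₂ h'.val₂, .val ⟨h'.val₁, h'.val₂, h'.typed₁,
        h'.typed₂, h'.eq_or.imp_right fun hd hl =>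
          hd ((FlowSetting.cl_perm _ _ inf_le_left _).trans hl)⟩, hs.top, hS₂, nofun⟩
  | deref a V ha =>
    rcases h.deref_val_inv trivial with h | ⟨A₂, l, rfl, hV, hl⟩
    · exact high h
    obtain ⟨a₂, rfl, ha₂, hθ₂⟩ := (hV.typed₂ ⊥ F Eff.none).eq_loc hΓ hV.val₂
    obtain ⟨a', ha', ha₁, hθ₁⟩ := (hV.typed₁ ⊥ F Eff.none).eq_loc hΓ hV.val₁
    cases ha'
    -- Well-formedness of the second configuration puts `a₂` in its store, so its dereferencing can
    -- fire.
    obtain ⟨V₂, hV₂⟩ := Option.ne_none_iff_exists'.1 (hM₂ (show a₂ ∈ ({a₂} : Set Ref) from rfl))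
    refine .inr ⟨.hole, _, _, _, _, rfl, .deref a₂ V₂ hV₂, .val ⟨V.2, V₂.2, ?_, ?_, ?_⟩, hs.top,
      hS₂, nofun⟩
    · exact hθ₁ ▸ hS₁ a V ha
    · exact hθ₂ ▸ hS₂ a₂ V₂ hV₂
    · rcases hV.eq_or with he | hd
      · cases he
        -- A common reference of visible level holds equal values in both stores. If its level is
        -- hidden, so is `r`, which dominates that level, and the values may differ.
        by_cases hlow : FlowLE F (Sg a).1 ℓ
        · have := hs.1 a hlow
          rw [ha, hV₂] at this
          cases this
          exact .inl rfl
        · exact .inr fun hc => not_cl_le_of_not_flowLE hlow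
            ((FlowSetting.cl_mono _ _ _ (ha₁.le.trans hl)).trans hc)
      · exact .inr hd
  | assign a V =>
    rcases h.assign_inv trivial V.2 with h | ⟨A₂, B₂, l, r₀, r₁, θ, rfl, rfl, hA, hB, he⟩
    · exact high h
    obtain ⟨a₂, rfl, ha₂, hθ₂⟩ := (hA.typed₂ ⊥ F Eff.none).eq_loc hΓ hA.val₂
    obtain ⟨a', ha', ha₁, hθ₁⟩ := (hA.typed₁ ⊥ F Eff.none).eq_loc hΓ hA.val₁
    cases ha'
    refine .inr ⟨.hole, _, _, _, _, rfl, .assign a₂ ⟨B₂, hB.val₂⟩,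
      .refl (s := Eff.none) (.nil ..) bot_le bot_le, ⟨?_, hs.top.2⟩,
      hS₂.update (hθ₂.symm ▸ hB.typed₂ ⊥ F Eff.none), nofun⟩
    rcases he with ⟨h₁, h₂⟩ | hl
    · cases h₁
      exact hs.top.1.update (.inl (Subtype.ext h₂))
    -- The references may be distinct here, but typing gives both the level `l`, so both updates are
    -- invisible.
    · exact (hs.top.1.update_left (ha₁ ▸ hl)).update_right (ha₂ ▸ hl)
  | newref l θ V a ha hl =>
    rcases h.newref_val_inv V.2 with h | ⟨A₂, r₀, rfl, rfl, hA, he⟩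
    · exact high h
    -- The second run allocates the same name, which the freshness condition of the bisimulation
    -- keeps out of its store.
    have ha₂ : a ∉ pdom S₂ := fun h => (Set.ext_iff.1 hfS a).1 ⟨⟨by simp [pdom], ha⟩, h⟩
    have hloc := Typed.loc (Sg := Sg) (Dom := Dom) (Up m) F Γ Eff.none a
    rw [hl] at hloc
    refine .inr ⟨.hole, _, _, _, _, rfl, .newref l θ ⟨A₂, hA.val₂⟩ a ha₂ hl,
      .refl hloc bot_le bot_le, ⟨hs.top.1.update ?_, hs.top.2⟩,
      hS₂.update (a := a) (by rw [hl]; exact hA.typed₂ ⊥ F Eff.none), nofun⟩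
    rw [hl]
    exact he.imp_left fun h => Subtype.ext h
  | allowedTrue G Nt Nf d A hd hA hF =>
    rcases h.allowed_inv with h | ⟨rfl, st, sf, ht, hf, h₁, h₂, hr, htt⟩
    · exact high h
    -- If the level of the thread is visible, both trackers place `m` in the same domain and the
    -- test has the same outcome. Otherwise the second run keeps its test unreduced, as a high
    -- partner of the chosen branch.
    by_cases hj : FlowLE F (Up m) ℓ
    · exact .inr ⟨.hole, _, _, _, _, rfl, .allowedTrue G _ _ d A (hs.2 m hj ▸ hd) hA hF,
        .refl ht ((le_sup_left.trans le_sup_left).trans hr)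
          ((le_sup_left.trans le_sup_left).trans htt), hs.top, hS₂, nofun⟩
    · exact .inl ⟨.high (HighPair.allowed ht hf h₁ h₂ hr htt hj).1, hs.top, nofun⟩
  | allowedFalse G Nt Nf d A hd hA hF =>
    rcases h.allowed_inv with h | ⟨rfl, st, sf, ht, hf, h₁, h₂, hr, htt⟩
    · exact high h
    by_cases hj : FlowLE F (Up m) ℓ
    · exact .inr ⟨.hole, _, _, _, _, rfl, .allowedFalse G _ _ d A (hs.2 m hj ▸ hd) hA hF,
        .refl hf ((le_sup_right.trans le_sup_left).trans hr)
          ((le_sup_right.trans le_sup_left).trans htt), hs.top, hS₂, nofun⟩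
    · exact .inl ⟨.high (HighPair.allowed ht hf h₁ h₂ hr htt hj).2, hs.top, nofun⟩
  | thread l N d n hn hl =>
    have hn₂ : n ∉ pdom T₂ := fun h => (Set.ext_iff.1 hfT n).1 ⟨⟨by simp [pdom], hn⟩, h⟩
    cases h with
    | high h => exact high h
    | val h => exact h.val₁.elim
    | refl hM hr ht =>
      cases hM with
      | mig _ _ _ _ _ _ _ hM =>
        refine .inr ⟨.hole, _, _, _, _, rfl, .thread l N d n hn₂ hl,
          .refl (s := Eff.none) (.nil ..) bot_le bot_le, ⟨hs.top.1, hs.top.2.update n d⟩, hS₂, ?_⟩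
        rintro n' N' h
        cases h
        exact ⟨_, _, hl ▸ hM⟩

/-- A step of the first of two related expressions is matched by the second one. -/
theorem Lockstep.matches_step
    (hΓ : ∀ (k : ℕ) (θ : Ty Lev Flo TyVar) (l : Lev), Γ k ≠ some (.ref θ l))
    (hR : Redex W Sg Up T₁ m S₁ R T₁' R' new S₁') (hS₁ : Compatible Sg Γ S₁)
    (hS₂ : Compatible Sg Γ S₂) (hfS : (pdom S₁' \ pdom S₁) ∩ pdom S₂ = ∅)
    (hfT : (pdom T₁' \ pdom T₁) ∩ pdom T₂ = ∅) (E : ECtx Lev Flo Ref Dom TyVar) :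
    ∀ {F : Flo} {M₂ : Exp Lev Flo Ref Dom TyVar} {r t : Lev} {τ : Ty Lev Flo TyVar},
      Lockstep Sg Γ ℓ (Up m) F (E.fill R) M₂ r t τ → M₂.rn ⊆ pdom S₂ →
      LowEqState Sg Up (F ⊓ E.policy) ℓ T₁ S₁ T₂ S₂ →
      Matches W Sg Up Γ ℓ m T₁' S₁' T₂ S₂ new
        (fun X => Lockstep Sg Γ ℓ (Up m) F (E.fill R') X r t τ) M₂ := by
  induction E with
  | hole =>
    intro F M₂ r t τ h hM₂ hs
    exact h.matches_redex hΓ hR hS₁ hS₂ hfS hfT hM₂ (by simpa [ECtx.policy] using hs)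
  | appL E N ih =>
    intro F M₂ r t τ h hM₂ hs
    -- Since a redex is not a value, neither is `E[R]`; this rules out a pair in which the argument
    -- is being evaluated.
    rcases h.appL_inv (E.not_isVal_fill hR.not_isVal) with h | ⟨A₂, r₀, t₀, τ', rfl, hA, hC⟩
    · exact h.matches (E := .appL E N) hR hS₁ hs
    · exact (ih hA (Set.subset_union_left.trans hM₂) hs).frame (.appL · N) (.app · N)
        (fun _ _ => rfl) fun X hX => hC _ X hX
  | appR V E ih =>
    intro F M₂ r t τ h hM₂ hs
    rcases h.appR_inv V.2 with h | ⟨A₂, B₂, r₀, r₁, t₁, s', τ', rfl, hV, hN, h₂, h₃, hr, ht⟩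
    · exact h.matches (E := .appR V E) hR hS₁ hs
    -- The second run evaluates its argument under its own function value, so the two evaluation
    -- contexts need not coincide.
    · exact (ih hN (Set.subset_union_right.trans hM₂) hs).frame (.appR ⟨A₂, hV.val₂⟩) (.app A₂)
        (fun _ _ => rfl) fun X hX => .appR hV hX h₂ h₃ hr ht
  | seq E N ih =>
    intro F M₂ r t τ h hM₂ hs
    rcases h.seq_inv with h | ⟨A₂, r₀, t₀, τ', rfl, hM, s', hN, h₁, hr, ht⟩
    · exact h.matches (E := .seq E N) hR hS₁ hs
    · exact (ih hM (Set.subset_union_left.trans hM₂) hs).frame (.seq · N) (.seq · N)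
        (fun _ _ => rfl) fun X hX => .seq hX hN h₁ hr ht
  | newref l θ E ih =>
    intro F M₂ r t τ h hM₂ hs
    rcases h.newref_inv with h | ⟨A₂, r₀, t₀, rfl, rfl, hM, h₁, h₂, hr, ht⟩
    · exact h.matches (E := .newref l θ E) hR hS₁ hs
    · exact (ih hM hM₂ hs).frame (.newref l θ) (.newref l θ)
        (fun _ _ => rfl) fun X hX => .newref hX h₁ h₂ hr ht
  | deref E ih =>
    intro F M₂ r t τ h hM₂ hs
    rcases h.deref_inv with h | ⟨A₂, l, r₀, t₀, rfl, hM, hr, ht⟩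
    · exact h.matches (E := .deref E) hR hS₁ hs
    · exact (ih hM hM₂ hs).frame .deref .deref (fun _ _ => rfl) fun X hX => .deref hX hr ht
  | assignL E N ih =>
    intro F M₂ r t τ h hM₂ hs
    rcases h.assignL_inv (E.not_isVal_fill hR.not_isVal) with h | ⟨A₂, r₀, t₀, τ', rfl, hA, hC⟩
    · exact h.matches (E := .assignL E N) hR hS₁ hs
    · exact (ih hA (Set.subset_union_left.trans hM₂) hs).frame (.assignL · N) (.assign · N)
        (fun _ _ => rfl) fun X hX => hC _ X hX
  | assignR V E ih =>
    intro F M₂ r t τ h hM₂ hs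
    rcases h.assignR_inv V.2 with h | ⟨A₂, B₂, l, r₀, r₁, t₁, θ, rfl, rfl, hV, hN, h₂, h₃, hr, ht⟩
    · exact h.matches (E := .assignR V E) hR hS₁ hs
    · exact (ih hN (Set.subset_union_right.trans hM₂) hs).frame (.assignR ⟨A₂, hV.val₂⟩)
        (.assign A₂) (fun _ _ => rfl) fun X hX => .assignR hV hX h₂ h₃ hr ht
  | cond E Nt Nf ih =>
    intro F M₂ r t τ h hM₂ hs
    rcases h.cond_inv with h | ⟨A₂, r₀, t₀, st, sf, rfl, hM, hNt, hNf, h₁, h₂, hr, ht⟩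
    · exact h.matches (E := .cond E Nt Nf) hR hS₁ hs
    · exact (ih hM ((Set.subset_union_left.trans Set.subset_union_left).trans hM₂) hs).frame
        (.cond · Nt Nf) (.cond · Nt Nf) (fun _ _ => rfl)
        fun X hX => .cond hX hNt hNf h₁ h₂ hr ht
  | flow G E ih =>
    intro F M₂ r t τ h hM₂ hs
    rcases h.flow_inv with h | ⟨A₂, rfl, hM⟩
    · exact h.matches (E := .flow G E) hR hS₁ hs
    -- The declared policy moves from the context into the ambient one; their meet, at which the
    -- states agree, is unchanged.
    · exact (ih hM hM₂ (by rwa [inf_assoc])).frame (.flow G) (.flow G) (fun _ _ => rfl)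
        fun X hX => .flow hX

omit [DecidableEq Ref] [DecidableEq Nam] in
theorem Lockstep.typed_left {j : Lev} {F : Flo} {M₁ M₂ : Exp Lev Flo Ref Dom TyVar} {r t : Lev}
    {τ : Ty Lev Flo TyVar} (h : Lockstep Sg Γ ℓ j F M₁ M₂ r t τ) :
    ∃ s, Typed Sg j F Γ M₁ s τ := by
  -- The induction must retain the bounds `r` and `t`, on which the side conditions of the enclosing
  -- rules are stated; the writing effect can be left open.
  suffices h : ∃ w, TypedLE Sg Γ j F M₁ ⟨r, w, t⟩ τ from h.elim fun _ h => h.imp fun _ h => h.2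
  induction h with
  | refl hM hr ht => exact ⟨_, _, ⟨hr, le_rfl, ht⟩, hM⟩
  | high h => exact ⟨_, h.choose_spec.2.2.2.1⟩
  | val h => exact ⟨⊤, h.typedLE₁ _⟩
  | appL _ hN h₁ h₂ h₃ hr ht ih =>
    obtain ⟨w, ih⟩ := ih
    exact ⟨_, ih.app hN.typedLE h₁ h₂ h₃ hr le_rfl ht⟩
  | @appR _ _ _ _ _ r₀ r₁ t₁ s' _ _ r t hV _ h₂ h₃ hr ht ih =>
    obtain ⟨w, ih⟩ := ih
    refine ⟨_, (hV.typedLE₁ Eff.none).app ih (flowLE_bot _) (flowLE_bot _) h₃ ?_ le_rfl ?_⟩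
    · exact (sup_le_sup_right (sup_le_sup_right bot_le _) _).trans hr
    · change (((⊥ : Lev) ⊔ s'.t) ⊔ t₁) ⊔ (⊥ ⊔ r₁) ≤ t
      rw [bot_sup_eq]
      exact (sup_le_sup_left (sup_le_sup_right bot_le _) _).trans ht
  | seq _ hN h₁ hr ht ih =>
    obtain ⟨w, ih⟩ := ih
    exact ⟨_, ih.seq hN.typedLE h₁ hr le_rfl ht⟩
  | newref _ h₁ h₂ hr ht ih =>
    obtain ⟨w, ih⟩ := ih
    exact ⟨_, ih.newref h₁ h₂ hr le_rfl ht⟩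
  | deref _ hr ht ih =>
    obtain ⟨w, ih⟩ := ih
    exact ⟨_, ih.deref hr le_rfl ht⟩
  | assignL _ hN h₁ h₂ h₃ hr ht ih =>
    obtain ⟨w, ih⟩ := ih
    exact ⟨_, ih.assign hN.typedLE h₁ h₂ h₃ hr le_rfl ht⟩
  | @assignR _ _ _ _ _ r₀ r₁ t₁ _ _ r t hV _ h₂ h₃ hr ht ih =>
    obtain ⟨w, ih⟩ := ih
    refine ⟨_, (hV.typedLE₁ Eff.none).assign ih (flowLE_bot _) (flowLE_bot _) h₃ ?_ le_rfl ?_⟩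
    · exact (sup_le_sup_right bot_le _).trans hr
    · change ⊥ ⊔ t₁ ≤ t
      rwa [bot_sup_eq]
  | cond _ hNt hNf h₁ h₂ hr ht ih =>
    obtain ⟨w, ih⟩ := ih
    exact ⟨_, ih.cond hNt hNf h₁ h₂ hr le_rfl ht⟩
  | flow _ ih =>
    obtain ⟨w, s, hs, ih⟩ := ih
    exact ⟨w, s, hs, .flow _ _ _ _ _ _ _ ih⟩


end Step

/-! ### Pools of threads -/

/-- Two threads of the same name are related if both are absent, if they are in lockstep, or if
only one of them is present and its writing effect is not visible. -/
def ThreadRel (Sg : Ref → Lev × Ty Lev Flo TyVar) (Γ : Ctx Lev Flo TyVar) (Up : Nam → Lev)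
    (ℓ : Lev) (m : Nam) : Option (Exp Lev Flo Ref Dom TyVar) →
      Option (Exp Lev Flo Ref Dom TyVar) → Prop
  | none, none => True
  | some M, none => HighThread Sg Γ Up ℓ m M
  | none, some M => HighThread Sg Γ Up ℓ m M
  | some M₁, some M₂ => ∃ r t τ, Lockstep Sg Γ ℓ (Up m) (⊤ : Flo) M₁ M₂ r t τ

theorem ThreadRel.symm {Sg : Ref → Lev × Ty Lev Flo TyVar} {Γ : Ctx Lev Flo TyVar} {Up : Nam → Lev}
    {ℓ : Lev} {m : Nam} : ∀ {M₁ M₂ : Option (Exp Lev Flo Ref Dom TyVar)},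
      ThreadRel Sg Γ Up ℓ m M₁ M₂ → ThreadRel Sg Γ Up ℓ m M₂ M₁
  | none, none, _ => trivial
  | some _, none, h => h
  | none, some _, h => h
  | some _, some _, ⟨r, t, τ, h⟩ => ⟨r, t, τ, h.symm⟩

section Pool

variable [DecidableEq Ref] [DecidableEq Nam] {W : Dom → Option Flo}
  {Sg : Ref → Lev × Ty Lev Flo TyVar} {Up : Nam → Lev} {Γ : Ctx Lev Flo TyVar} {ℓ : Lev} {m : Nam}
  {P₁ P₂ : Pool Lev Flo Ref Nam Dom TyVar} {M₁ M₂ : Exp Lev Flo Ref Dom TyVar}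
  {new : Option (Nam × Exp Lev Flo Ref Dom TyVar)}

omit [DecidableEq Ref] in
/-- Related pools stay related when the second one stands still. -/
theorem ThreadRel.next_left (h : ∀ x, ThreadRel Sg Γ Up ℓ x (P₁ x) (P₂ x))
    (hm : ThreadRel Sg Γ Up ℓ m (some M₁) (P₂ m))
    (hn : ∀ n N, new = some (n, N) → HighThread Sg Γ Up ℓ n N ∧ P₂ n = none) (x : Nam) :
    ThreadRel Sg Γ Up ℓ x (P₁.next m M₁ new x) (P₂ x) := by
  have h₁ : ∀ y, ThreadRel Sg Γ Up ℓ y (Function.update P₁ m (some M₁) y) (P₂ y) := by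
    intro y
    by_cases hy : y = m
    · subst hy; rwa [Function.update_self]
    · rw [Function.update_of_ne hy]; exact h y
  rcases new with _ | ⟨n, N⟩
  · exact h₁ x
  · obtain ⟨hN, hP⟩ := hn n N rfl
    change ThreadRel Sg Γ Up ℓ x (Function.update (Function.update P₁ m (some M₁)) n (some N) x) _
    by_cases hx : x = n
    · subst hx; rw [Function.update_self, hP]; exact hN
    · rw [Function.update_of_ne hx]; exact h₁ x

omit [DecidableEq Ref] in
/-- Related pools stay related when both make a step that creates the same thread. -/
theorem ThreadRel.next (h : ∀ x, ThreadRel Sg Γ Up ℓ x (P₁ x) (P₂ x))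
    (hm : ThreadRel Sg Γ Up ℓ m (some M₁) (some M₂))
    (hn : ∀ n N, new = some (n, N) → ∃ s τ, Typed Sg (Up n) (⊤ : Flo) Γ N s τ) (x : Nam) :
    ThreadRel Sg Γ Up ℓ x (P₁.next m M₁ new x) (P₂.next m M₂ new x) := by
  have h₁ : ∀ y, ThreadRel Sg Γ Up ℓ y (Function.update P₁ m (some M₁) y)
      (Function.update P₂ m (some M₂) y) := by
    intro y
    by_cases hy : y = m
    · subst hy; rwa [Function.update_self, Function.update_self]
    · rw [Function.update_of_ne hy, Function.update_of_ne hy]; exact h y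
  rcases new with _ | ⟨n, N⟩
  · exact h₁ x
  · obtain ⟨s, τ, hN⟩ := hn n N rfl
    change ThreadRel Sg Γ Up ℓ x (Function.update (Function.update P₁ m (some M₁)) n (some N) x)
      (Function.update (Function.update P₂ m (some M₂)) n (some N) x)
    by_cases hx : x = n
    · subst hx
      rw [Function.update_self, Function.update_self]
      exact ⟨_, _, _, .refl hN le_rfl le_rfl⟩
    · rw [Function.update_of_ne hx, Function.update_of_ne hx]; exact h₁ x

/-- Thread-wise relatedness of pools is a bisimulation. -/
theorem isBisim_threadRel
    (hΓ : ∀ (k : ℕ) (θ : Ty Lev Flo TyVar) (l : Lev), Γ k ≠ some (.ref θ l)) :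
    IsBisim W Sg Up Γ ℓ fun c₁ c₂ : ThreadConf Lev Flo Ref Nam Dom TyVar =>
      ∀ x, ThreadRel Sg Γ Up ℓ x (c₁.1 x) (c₂.1 x) := by
  refine ⟨fun c₁ c₂ h x => (h x).symm, ?_⟩
  intro P₁ P₂ P₁' T₁ T₂ T₁' S₁ S₂ S₁' F d hS₁ hS₂ hwf h hstep hs hfS hfT
  obtain ⟨m, E, R, R', new, hm, hR, rfl, rfl⟩ : ∃ m E R R' new, P₁ m = some (ECtx.fill R E) ∧
      Redex W Sg Up T₁ m S₁ R T₁' R' new S₁' ∧ P₁' = P₁.next m (E.fill R') new ∧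
      F = E.policy := by
    cases hstep with
    | mk _ _ _ _ _ m d E R R' new _ hm _ hR => exact ⟨m, E, R, R', new, hm, hR, rfl, rfl⟩
  -- A newly created name is absent from the second tracker by the freshness condition, hence from
  -- the second pool by well-formedness.
  have hnew : ∀ n N, new = some (n, N) → P₂ n = none := by
    intro n N hn
    obtain ⟨hn₁, hn₁'⟩ := hR.fresh hn
    by_contra hP
    exact (Set.ext_iff.1 hfT n).1 ⟨⟨hn₁', hn₁⟩, hwf.pool_dom hP⟩
  have hmr := h m
  simp only [hm] at hmr
  cases hm₂ : P₂ m with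
  | none =>
    rw [hm₂] at hmr
    -- A thread without counterpart is high, so the second configuration stands still; the writing
    -- effect itself serves as the hidden level.
    obtain ⟨s, τ, hT, hw⟩ := hmr
    obtain ⟨⟨s', hs', hT'⟩, hst, hhigh⟩ := hT.high_step hw le_rfl hR hS₁
    obtain ⟨F', s₁, τ₁, hT₁, -⟩ := hT.of_fill
    refine ⟨P₂, T₂, S₂, .inl rfl, hst.trans hs.top, ThreadRel.next_left h ?_
      fun n N hn => ⟨hhigh n N hn, hnew n N hn⟩, hR.compatible hS₁ hT₁, hS₂⟩
    simp only [hm₂]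
    exact ⟨s', τ, hT', fun hl => hw (hs'.2.1.trans hl)⟩
  | some M₂ =>
    rw [hm₂] at hmr
    obtain ⟨r, t, τ, hL⟩ := hmr
    -- Compatibility of the new first store needs a typing of the first redex, extracted from the
    -- lockstep pair.
    obtain ⟨s, hT⟩ := hL.typed_left
    obtain ⟨F', s₁, τ₁, hT₁, -⟩ := hT.of_fill
    have hS₁' := hR.compatible hS₁ hT₁
    -- Threads are typed under `⊤`, so the policy at which low-equality is needed is exactly the one
    -- declared by `E`.
    rcases hL.matches_step hΓ hR hS₁ hS₂ hfS hfT E (hwf.pool_rn m M₂ hm₂)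
      (by rwa [top_inf_eq]) with ⟨hL', hst, hn⟩ | ⟨E₂, R₂, R₂', T₂', S₂', rfl, hR₂, hL', hst, hS₂', hn⟩
    · refine ⟨P₂, T₂, S₂, .inl rfl, hst, ThreadRel.next_left h ?_
        fun n N h => ⟨hn n N h, hnew n N h⟩, hS₁', hS₂⟩
      simp only [hm₂]
      exact ⟨r, t, τ, hL'⟩
    · have hdom : T₂ m ≠ none := hwf.pool_dom (show P₂ m ≠ none by simp [hm₂])
      obtain ⟨d₂, hd₂⟩ := Option.ne_none_iff_exists'.1 hdom
      exact ⟨_, T₂', S₂', .inr ⟨_, d₂, .mk T₂ T₂' P₂ S₂ S₂' m d₂ E₂ R₂ R₂' new hwf hm₂ hd₂ hR₂⟩,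
        hst, ThreadRel.next h ⟨r, t, τ, hL'⟩ hn, hS₁', hS₂'⟩

end Pool

end Bisimulation

end DistND

/-! ### Soundness: a typed pool is related to itself. -/

theorem mainTheorem2 {Lev Flo Ref Nam Dom TyVar : Type*}
    [Lattice Lev] [BoundedOrder Lev] [Lattice Flo] [BoundedOrder Flo]
    [DistND.FlowSetting Lev Flo] [DecidableEq Ref] [DecidableEq Nam]
    (W : Dom → Option Flo) (Sg : Ref → Lev × DistND.Ty Lev Flo TyVar) (Up : Nam → Lev)
    (Γ : DistND.Ctx Lev Flo TyVar)
    (hΓ : ∀ (k : ℕ) (θ : DistND.Ty Lev Flo TyVar) (l : Lev), Γ k ≠ some (.ref θ l))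
    (P : DistND.Pool Lev Flo Ref Nam Dom TyVar)
    (hP : ∀ m M, P m = some M → ∃ s τ, DistND.Typed Sg (Up m) (⊤ : Flo) Γ M s τ) :
    DistND.DND W Sg Up Γ P := by
  intro ℓ T₁ T₂ _ _ _
  refine ⟨_, DistND.isBisim_threadRel hΓ, fun x => ?_⟩
  change DistND.ThreadRel Sg Γ Up ℓ x (P x) (P x)
  cases hx : P x with
  | none => trivial
  | some M =>
    obtain ⟨s, τ, h⟩ := hP x M hx
    exact ⟨s.r, s.t, τ, .refl h le_rfl le_rfl⟩
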